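/- Let $n\ge 2$ and let $M$ be a smooth manifold of dimension $4n$ with a smooth almost hypercomplex structure $H=(J_1,J_2,J_3)$, i.e. $J_\alpha^2=-I$ and $J_\alpha=J_\beta\circ J_\gamma=-J_\gamma\circ J_\beta$ for all cyclic permutations $(\alpha,\beta,\gamma)$ of $(1,2,3)$. Let $g$ be a smooth pseudo-Riemannian metric on $M$ of neutral signature $(2n,2n)$ such that $$g(x,y)=\varepsilon_\alpha\, g(J_\alpha x,J_\alpha y),\qquad \varepsilon_1=1,\quad \varepsilon_2=\varepsilon_3=-1,$$ for all tangent vectors $x,y$ at the same point and all $\alpha$ (so $g$ is Hermitian with respect to $J_1$ and Norden with respect to $J_2$ and $J_3$). Let $\nabla$ be the Levi-Civita connection of $g$, and assume that $(M,H,g)$ is quaternionic Kähler, i.e. the bundle $Q=\{\lambda_1J_1+\lambda_2J_2+\lambda_3J_3\}$ of endomorphisms of $TM$ is $\nabla$-parallel: every $\nabla_xJ_\alpha$ is a linear combination of $J_1,J_2,J_3$ (equivalently, $(\nabla_xJ_\alpha)y=\omega_\gamma(x)J_\beta y-\omega_\beta(x)J_\gamma y$ for all cyclic permutations $(\alpha,\beta,\gamma)$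 of $(1,2,3)$, with 1-forms $\omega_1,\omega_2,\omega_3$). Then $(M,g)$ is Einstein: if $R(x,y)z=\nabla_x\nabla_yz-\nabla_y\nabla_xz-\nabla_{[x,y]}z$ is the curvature tensor and $\rho(y,z)=\operatorname{tr}\bigl(x\mapsto R(x,y)z\bigr)$ the Ricci tensor of $g$, then $$\rho=\lambda g$$ for a locally constant function $\lambda:M\to\mathbb{R}$. In particular, if $M$ is connected, then $\rho=\lambda g$ with a single constant $\lambda\in\mathbb{R}$. -/

import Mathlib

open Bundle Manifold
open scoped ContDiff Manifold Matrix

noncomputable section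

namespace NHGeometry

section Calculus

variable {m : ℕ} {M : Type*} [TopologicalSpace M] [ChartedSpace (EuclideanSpace ℝ (Fin m)) M]

/-- A (not necessarily smooth) field of vectors on the `m`-dimensional manifold `M`. Smoothness is
only needed, and only available, near the points where such a field is differentiated. -/
abbrev VField (m : ℕ) (M : Type*) [TopologicalSpace M]
    [ChartedSpace (EuclideanSpace ℝ (Fin m)) M] : Type _ :=
  (p : M) → TangentSpace (𝓡 m) p

/-- The `i`-th vector of the standard basis of `T_p M` (the `i`-th coordinate vector at `p` of the
preferred chart at `p`). -/
def frame (p : M) (i : Fin m) : TangentSpace (𝓡 m) p :=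
  (EuclideanSpace.single i (1 : ℝ) : EuclideanSpace ℝ (Fin m))

/-- The `i`-th coordinate of a tangent vector with respect to the basis `frame p`. -/
def coord {p : M} (v : TangentSpace (𝓡 m) p) (i : Fin m) : ℝ :=
  (show EuclideanSpace ℝ (Fin m) from v) i

variable [IsManifold (𝓡 m) ∞ M]

/-- Extension of a tangent vector at `p` to a vector field which is smooth near `p` (with constant
components in the preferred chart at `p`). -/
def ext {p : M} (v : TangentSpace (𝓡 m) p) : VField m M :=
  FiberBundle.extend (EuclideanSpace ℝ (Fin m)) v

variable (m M) in
/-- A smooth pseudo-Riemannian metric on `M`: a smooth field of nondegenerate symmetric bilinear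
forms on the tangent spaces (of arbitrary signature). -/
structure PseudoRiemannianMetric where
  /-- The bilinear form on each tangent space. -/
  val (p : M) : TangentSpace (𝓡 m) p →L[ℝ] TangentSpace (𝓡 m) p →L[ℝ] ℝ
  symm (p : M) (u v : TangentSpace (𝓡 m) p) : val p u v = val p v u
  nondegenerate (p : M) (u : TangentSpace (𝓡 m) p) (h : ∀ v, val p u v = 0) : u = 0
  contMDiff : ContMDiff (𝓡 m)
    ((𝓡 m).prod 𝓘(ℝ, EuclideanSpace ℝ (Fin m) →L[ℝ] EuclideanSpace ℝ (Fin m) →L[ℝ] ℝ)) ∞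
    (fun p ↦ TotalSpace.mk' (EuclideanSpace ℝ (Fin m) →L[ℝ] EuclideanSpace ℝ (Fin m) →L[ℝ] ℝ)
      (E := fun p : M ↦ TangentSpace (𝓡 m) p →L[ℝ] TangentSpace (𝓡 m) p →L[ℝ] ℝ) p (val p))

namespace PseudoRiemannianMetric

variable (g : PseudoRiemannianMetric m M)

/-- The quadratic form `v ↦ g(v, v)` on `T_p M`. -/
def quadForm (p : M) : QuadraticForm ℝ (TangentSpace (𝓡 m) p) :=
  LinearMap.BilinMap.toQuadraticMap
    ((ContinuousLinearMap.coeLM ℝ).comp (g.val p).toLinearMap :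
      LinearMap.BilinForm ℝ (TangentSpace (𝓡 m) p))

/-- The metric is neutral: at every point it has as many positive as negative squares, i.e. its
signature is `(k, k)` with `m = 2 k`. -/
def IsNeutral : Prop :=
  ∀ p : M, 2 * sigPos (g.quadForm p) = m ∧ 2 * sigNeg (g.quadForm p) = m

/-- The Gram matrix `(g_{ij})` of the metric at `p` with respect to the basis `frame p`. -/
def gram (p : M) : Matrix (Fin m) (Fin m) ℝ :=
  Matrix.of fun i j ↦ g.val p (frame p i) (frame p j)

/-- The right hand side of the Koszul formula, i.e. the function
`½ (X g(Y,Z) + Y g(X,Z) - Z g(X,Y) + g([X,Y],Z) - g([X,Z],Y) - g([Y,Z],X))`. -/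
def koszul (X Y Z : VField m M) (p : M) : ℝ :=
  (mvfderiv (𝓡 m) (fun q ↦ g.val q (Y q) (Z q)) p (X p)
    + mvfderiv (𝓡 m) (fun q ↦ g.val q (X q) (Z q)) p (Y p)
    - mvfderiv (𝓡 m) (fun q ↦ g.val q (X q) (Y q)) p (Z p)
    + g.val p (VectorField.mlieBracket (𝓡 m) X Y p) (Z p)
    - g.val p (VectorField.mlieBracket (𝓡 m) X Z p) (Y p)
    - g.val p (VectorField.mlieBracket (𝓡 m) Y Z p) (X p)) / 2

/-- The Levi-Civita connection `∇_X Y` of `g`. Its value at `p` is the vector `w` determined by the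
Koszul formula `g(w, e_j) = koszul X Y e_j` for the basis `e_j` of `T_p M`, that is
`w = ∑_{i,j} g^{ij} koszul(X, Y, e_j) e_i`. -/
def nabla (X Y : VField m M) : VField m M := fun p ↦
  ∑ i, ∑ j, ((g.gram p)⁻¹ i j * g.koszul X Y (ext (frame p j)) p) • frame p i

/-- The covariant derivative of a field `A` of endomorphisms of the tangent spaces:
`(∇_x A) y = ∇_x (A y) - A (∇_x y)`, where `x, y ∈ T_p M`. -/
def nablaEnd (A : (p : M) → TangentSpace (𝓡 m) p →L[ℝ] TangentSpace (𝓡 m) p) (p : M)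
    (x y : TangentSpace (𝓡 m) p) : TangentSpace (𝓡 m) p :=
  g.nabla (ext x) (fun q ↦ A q (ext y q)) p - A p (g.nabla (ext x) (ext y) p)

/-- The curvature tensor `R(x,y)z = ∇_x ∇_y z - ∇_y ∇_x z - ∇_{[x,y]} z`, where
`x, y, z ∈ T_p M`. -/
def curvature (p : M) (x y z : TangentSpace (𝓡 m) p) : TangentSpace (𝓡 m) p :=
  g.nabla (ext x) (g.nabla (ext y) (ext z)) p - g.nabla (ext y) (g.nabla (ext x) (ext z)) p
    - g.nabla (VectorField.mlieBracket (𝓡 m) (ext x) (ext y)) (ext z) p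

/-- The Ricci tensor `ρ(y,z) = trace (x ↦ R(x,y)z) = g^{ij} g(R(e_i,y)z, e_j)`. -/
def ricci (p : M) (y z : TangentSpace (𝓡 m) p) : ℝ :=
  ∑ i, coord (g.curvature p (frame p i) y z) i

end PseudoRiemannianMetric

variable (m M) in
/-- An almost hypercomplex structure `H = (J_1, J_2, J_3)` on `M`: three smooth almost complex
structures with `J_α = J_β ∘ J_γ = - J_γ ∘ J_β` for the cyclic permutations `(α, β, γ)` of
`(1, 2, 3)`. The indices `1, 2, 3` are represented by `0, 1, 2 : Fin 3`, so that
`(α, α + 1, α + 2)` runs through the cyclic permutations. -/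
structure AlmostHypercomplex where
  /-- The three almost complex structures. -/
  J (a : Fin 3) (p : M) : TangentSpace (𝓡 m) p →L[ℝ] TangentSpace (𝓡 m) p
  contMDiff (a : Fin 3) : ContMDiff (𝓡 m)
    ((𝓡 m).prod 𝓘(ℝ, EuclideanSpace ℝ (Fin m) →L[ℝ] EuclideanSpace ℝ (Fin m))) ∞
    (fun p ↦ TotalSpace.mk' (EuclideanSpace ℝ (Fin m) →L[ℝ] EuclideanSpace ℝ (Fin m))
      (E := fun p : M ↦ TangentSpace (𝓡 m) p →L[ℝ] TangentSpace (𝓡 m) p) p (J a p))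
  sq (a : Fin 3) (p : M) (v : TangentSpace (𝓡 m) p) : J a p (J a p v) = -v
  mul (a : Fin 3) (p : M) (v : TangentSpace (𝓡 m) p) :
    J a p v = J (a + 1) p (J (a + 2) p v)
  mul' (a : Fin 3) (p : M) (v : TangentSpace (𝓡 m) p) :
    J a p v = -J (a + 2) p (J (a + 1) p v)

/-- The signs `ε_1 = 1`, `ε_2 = ε_3 = -1`. -/
def sgn : Fin 3 → ℝ := ![1, -1, -1]

/-- `g` is an NH-metric for `H`: a neutral metric with `g(x, y) = ε_α g(J_α x, J_α y)`, i.e.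
`J_1` acts as an isometry (`g` is Hermitian for `J_1`) and `J_2`, `J_3` act as anti-isometries
(`g` is a Norden metric for `J_2` and for `J_3`). -/
structure IsNHMetric (H : AlmostHypercomplex m M) (g : PseudoRiemannianMetric m M) : Prop where
  neutral : g.IsNeutral
  compatible (a : Fin 3) (p : M) (x y : TangentSpace (𝓡 m) p) :
    g.val p x y = sgn a * g.val p (H.J a p x) (H.J a p y)

/-- `(M, H, g)` is quaternionic Kähler: the bundle `Q` of endomorphisms spanned by `J_1, J_2, J_3`
is parallel for the Levi-Civita connection of `g`, i.e. every `∇_x J_α` is a linear combination of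
`J_1, J_2, J_3`. (By `J_α² = -1` and `J_α = J_β J_γ` the coefficients are then automatically of
the form `(∇_x J_α) y = ω_γ(x) J_β y - ω_β(x) J_γ y` with 1-forms `ω_1, ω_2, ω_3`.) -/
def IsQuaternionicKahler (H : AlmostHypercomplex m M) (g : PseudoRiemannianMetric m M) : Prop :=
  ∀ (a : Fin 3) (p : M) (x : TangentSpace (𝓡 m) p), ∃ c : Fin 3 → ℝ,
    ∀ y : TangentSpace (𝓡 m) p, g.nablaEnd (H.J a) p x y = ∑ b, c b • H.J b p y

end Calculus

end NHGeometry

end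

/-!
Here `J_1` is skew for `g`, while `J_2` and `J_3` are self-adjoint. As `∇_x J_α` is of the same kind
as `J_α`, anticommutes with `J_α`, and is a combination of `J_1, J_2, J_3`, it follows that `∇ J_1 =
0`, `∇ J_2 = ω J_3` and `∇ J_3 = -ω J_2` for a single 1-form `ω`. By the Ricci identity the
curvature commutes with `J_1`, and `[R(x, y), J_2] = dω(x, y) J_3` (`curvEnd_comm_zero`,
`curvEnd_comm_one`).

The rest of the Einstein condition is algebra (`IsCurvatureLike.exists_ricciForm_eq_smul`).
Contractions of the first Bianchi identity give `n dω(y, z) = Ric(y, J_1 z)` and, for `n ≠ 1`,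
`Ric(J_2 y, J_2 z) = -Ric(y, z)`. Averaging `R` over `J_2` in either pair of arguments gives a tensor
of the form `B ⊗ F` with `F = g(J_1 ·, ·)`, and the pair symmetry makes `B` a multiple of `F`. Since
`B(y, z) = (2 / n) Ric(y, J_1 z)`, the Ricci tensor is `λ g`.

Then `n dω = -λ F`, where `dω` is closed and `F` is closed because `J_1` is parallel. Hence
`dλ ∧ F = 0`, and `dλ = 0` since `F` is nondegenerate in dimension greater than `2`
(`IsQuaternionicKahlerOn.hasFDerivAt_einstein`).

All this is carried out for a metric on an open subset of a vector space. The connection of the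
manifold is defined by the Koszul formula with vector fields adapted to the preferred chart at each
point, which may vary from point to point. To read it in one fixed chart, vector fields are replaced
by their components (`hat`); the Koszul formula is invariant under this, so the connection and the
curvature take their usual coordinate form (`hat_nabla`, `ofTangent_curvature`).
-/

noncomputable section

namespace NHGeometry

/-! ### Algebraic curvature tensors -/

section CurvatureAlgebra

open LinearMap

variable {V : Type*} [AddCommGroup V] [Module ℝ V]

theorem trace_eq_of_adjoint [FiniteDimensional ℝ V] {g : V →ₗ[ℝ] V →ₗ[ℝ] ℝ}
    (hnd : ∀ u, (∀ v, g u v = 0) → u = 0) {S T : V →ₗ[ℝ] V}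
    (h : ∀ x y, g (S x) y = g x (T y)) : trace ℝ V S = trace ℝ V T := by
  have hinj : Function.Injective g := by
    rw [← LinearMap.ker_eq_bot, LinearMap.ker_eq_bot']
    intro u hu
    exact hnd u fun v => by rw [hu]; rfl
  let e : V ≃ₗ[ℝ] Module.Dual ℝ V :=
    LinearEquiv.ofInjectiveOfFinrankEq g hinj (Subspace.dual_finrank_eq).symm
  have he : ∀ x, e x = g x := fun x => rfl
  have hconj : e.conj S = Module.Dual.transpose (R := ℝ) T := by
    ext f y
    obtain ⟨x, rfl⟩ := e.surjective f
    have h1 : e.conj S (e x) = e (S x) := by simp [LinearEquiv.conj_apply]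
    rw [h1, he, he, h, Module.Dual.transpose_apply]
    rfl
  rw [← LinearMap.trace_transpose' T, ← hconj, LinearMap.trace_conj']

/-- The Ricci form `(y, z) ↦ tr (x ↦ R(x, y) z)` of a curvature-like trilinear map. -/
def ricciForm (R : V →ₗ[ℝ] V →ₗ[ℝ] V →ₗ[ℝ] V) (y z : V) : ℝ :=
  trace ℝ V ((R.flip y).flip z)

/-- The endomorphism whose trace is the Ricci form is `x ↦ R(x, y)z`. -/
theorem flip_flip_apply (R : V →ₗ[ℝ] V →ₗ[ℝ] V →ₗ[ℝ] V) (x y z : V) :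
    ((R.flip y).flip z) x = R x y z := rfl

/-- Algebraic curvature tensors of the pseudo-Euclidean space `(V, g)`. Only the defining symmetries
are recorded; the pair symmetry `g(R(x, y)z, w) = g(R(z, w)x, y)` follows from them. -/
structure IsCurvatureLike (g : V →ₗ[ℝ] V →ₗ[ℝ] ℝ) (R : V →ₗ[ℝ] V →ₗ[ℝ] V →ₗ[ℝ] V) : Prop where
  swap (x y z : V) : R x y z = -R y x z
  skew (x y z w : V) : g (R x y z) w = -g z (R x y w)
  bianchi (x y z : V) : R x y z + R y z x + R z x y = 0

namespace IsCurvatureLike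

variable {g : V →ₗ[ℝ] V →ₗ[ℝ] ℝ} {R : V →ₗ[ℝ] V →ₗ[ℝ] V →ₗ[ℝ] V}

theorem pair_symm (hR : IsCurvatureLike g R) (hg : ∀ u v, g u v = g v u) (x y z w : V) :
    g (R x y z) w = g (R z w x) y := by
  have b : ∀ x y z w, g (R x y z) w + g (R y z x) w + g (R z x y) w = 0 := fun x y z w => by
    have := congrArg (fun v => g v w) (hR.bianchi x y z)
    simpa using this
  have s : ∀ x y z w, g (R x y z) w = -g (R y x z) w := fun x y z w => by
    rw [hR.swap]; simp
  have k : ∀ x y z w, g (R x y z) w = -g (R x y w) z := fun x y z w => by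
    rw [hR.skew, hg]
  linarith [b x y z w, b y z w x, b z w x y, b w x y z, s x y z w, s x w y z, k x y z w,
    k x y w z, k y z x w, k y z w x, k z x y w, k z x w y, s y z x w, s z x y w, s z w x y,
    s z w y x, k z w x y, k w x y z, s w x y z, s w x z y, k w y x z, k y w z x, s w y x z,
    s w y z x, k w y z x, s x z y w, s x z w y, k x z y w, k w x z y, s x w z y, k y w x z]

theorem ricciForm_symm [FiniteDimensional ℝ V] (hR : IsCurvatureLike g R)
    (hg : ∀ u v, g u v = g v u) (hnd : ∀ u, (∀ v, g u v = 0) → u = 0) (y z : V) :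
    ricciForm R y z = ricciForm R z y := by
  refine trace_eq_of_adjoint hnd fun x w => ?_
  simp only [flip_flip_apply]
  rw [hR.pair_symm hg, hR.skew, hR.swap z w]
  simp

/-- The trace of the first Bianchi identity, composed with an endomorphism `I` that commutes with
the curvature. -/
theorem trace_comp_eq (hR : IsCurvatureLike g R) {I : V →ₗ[ℝ] V}
    (hI : ∀ x y z, R x y (I z) = I (R x y z)) (y z : V) :
    trace ℝ V (I ∘ₗ R y z) = ricciForm R z (I y) - ricciForm R y (I z) := by
  rw [ricciForm, ricciForm, ← map_sub]
  congr 1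
  ext x
  have h := hR.bianchi x y z
  have h2 := hR.swap z x y
  simp only [LinearMap.comp_apply, LinearMap.sub_apply, flip_flip_apply, hI]
  rw [← map_sub]
  congr 1
  rw [h2] at h
  rw [← sub_eq_zero, ← h]
  abel

theorem ricciForm_invariant [FiniteDimensional ℝ V] (hR : IsCurvatureLike g R) (hg : ∀ u v, g u v = g v u)
    (hnd : ∀ u, (∀ v, g u v = 0) → u = 0) {I : V →ₗ[ℝ] V} (hI2 : ∀ x, I (I x) = -x)
    (hgI : ∀ x y, g (I x) y = -g x (I y))
    (hI : ∀ x y z, R x y (I z) = I (R x y z)) (y z : V) :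
    ricciForm R (I y) (I z) = ricciForm R y z := by
  -- by pair symmetry, `R` is also `I`-invariant in its first two arguments
  have hI' : ∀ x y z, R x (I y) z = -R (I x) y z := fun x y z => by
    refine sub_eq_zero.1 (hnd _ fun w => ?_)
    rw [map_sub, LinearMap.sub_apply, hR.pair_symm hg x, map_neg, LinearMap.neg_apply,
      hR.pair_symm hg (I x), hI, hgI]
    ring
  have h1 : (R.flip (I y)).flip (I z) = (-I) ∘ₗ (((R.flip y).flip z) ∘ₗ I) := by
    ext x
    simp [hI, hI']
  have h2 : (((R.flip y).flip z) ∘ₗ I) ∘ₗ (-I) = (R.flip y).flip z := by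
    ext x
    simp [hI2]
  rw [ricciForm, h1, LinearMap.trace_comp_comm', h2, ricciForm]

/-- The pointwise reason for the Einstein condition. If `R` commutes with the skew `I`, and with the
self-adjoint `J` up to `A(x, y) I J`, then `Ric` determines `A` by `n A(y, z) = Ric(y, Iz)`. The first
Bianchi identity, contracted after composition with `J`, then forces `Ric(Jy, Jz) = -Ric(y, z)`; this
is where `n ≠ 1` is needed. By the pair symmetry of `R`, the form `A + A(J·, J·)` is a multiple of the
Kähler form `g(I·, ·)`, and it equals `(2 / n) Ric(·, I·)`. -/
theorem exists_ricciForm_eq_smul [FiniteDimensional ℝ V] (hR : IsCurvatureLike g R)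
    (hg : ∀ u v, g u v = g v u) (hnd : ∀ u, (∀ v, g u v = 0) → u = 0)
    {n : ℕ} (hn : 2 ≤ n) (hdim : Module.finrank ℝ V = 4 * n)
    {I J : V →ₗ[ℝ] V} (hI2 : ∀ x, I (I x) = -x) (hJ2 : ∀ x, J (J x) = -x)
    (hIJ : ∀ x, J (I x) = -I (J x))
    (hgI : ∀ x y, g (I x) y = -g x (I y)) (hgJ : ∀ x y, g (J x) y = g x (J y))
    (hI : ∀ x y z, R x y (I z) = I (R x y z)) {A : V →ₗ[ℝ] V →ₗ[ℝ] ℝ}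
    (hJ : ∀ x y z, R x y (J z) = J (R x y z) + A x y • I (J z)) :
    ∃ c : ℝ, (∀ y z, ricciForm R y z = c * g y z) ∧ ∀ y z, A y z = c / n * g y (I z) := by
  have hn0 : (n : ℝ) ≠ 0 := by positivity
  have hn1 : (n : ℝ) ≠ 1 := by exact_mod_cast (show n ≠ 1 by omega)
  have hsymm := hR.ricciForm_symm hg hnd
  have hinv := hR.ricciForm_invariant hg hnd hI2 hgI hI
  have hskew : ∀ y z, ricciForm R (I y) z = -ricciForm R y (I z) := fun y z => by
    rw [← hinv y (I z), hI2, ricciForm, ricciForm]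
    simp
  -- the trace of `I ∘ R(y, z)`: conjugating by `J` changes `I` to `-I`
  have hA : ∀ y z, A y z = 1 / n * ricciForm R y (I z) := fun y z => by
    have h1 : trace ℝ V (I ∘ₗ R y z) = -2 * ricciForm R y (I z) := by
      rw [hR.trace_comp_eq hI, hsymm z, hskew]; ring
    have h2 : I ∘ₗ R y z = J ∘ₗ ((I ∘ₗ R y z) ∘ₗ J) + (-A y z) • LinearMap.id := by
      ext x
      simp [hJ, hIJ, hI2, hJ2]
    have h3 : ((I ∘ₗ R y z) ∘ₗ J) ∘ₗ J = -(I ∘ₗ R y z) := by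
      ext x
      simp [hJ2]
    have h4 := congrArg (trace ℝ V) h2
    rw [map_add, LinearMap.trace_comp_comm' _ J, h3, map_smul, LinearMap.trace_id, hdim, map_neg,
      h1, smul_eq_mul] at h4
    push_cast at h4
    field_simp
    linarith
  -- the Ricci form and its `J`-transform, in terms of `A`
  have hstar : ∀ y z, ricciForm R y z + ricciForm R (J z) (J y)
      = A (I z) y + A (I (J y)) (J z) := fun y z => by
    -- the trace of a skew endomorphism composed with a self-adjoint one vanishes
    have t0 : trace ℝ V (J ∘ₗ R y (J z)) = 0 := by
      have h : trace ℝ V (J ∘ₗ R y (J z)) = trace ℝ V (-(R y (J z) ∘ₗ J)) :=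
        trace_eq_of_adjoint hnd fun a b => by simp [hgJ, hR.skew]
      rw [map_neg, LinearMap.trace_comp_comm' J] at h
      linarith
    -- the first Bianchi identity for `x, y, Jz`, composed with `J`
    have e1 : (R.flip y).flip z + (R.flip (J z)).flip (J y)
        = (A.flip y).smulRight (I z) + J ∘ₗ R y (J z) + (A.flip (J z)).smulRight (I (J y)) := by
      ext x
      have b := congrArg J (hR.bianchi x y (J z))
      simp only [hJ, hR.swap (J z) x, map_add, map_neg, map_smul, hJ2, hIJ, map_zero] at b
      simp only [LinearMap.add_apply, LinearMap.smulRight_apply,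
        LinearMap.flip_apply, LinearMap.comp_apply, hJ]
      rw [← sub_eq_zero, ← neg_eq_zero, ← b]
      module
    have := congrArg (trace ℝ V) e1
    simpa [t0, ricciForm] using this
  have hanti : ∀ y z, ricciForm R (J y) (J z) = -ricciForm R y z := fun y z => by
    have h := hstar y z
    rw [hA, hA, hinv, hinv, hsymm z y, hsymm (J z)] at h
    have h' : ((n : ℝ) - 1) * (ricciForm R y z + ricciForm R (J y) (J z)) = 0 := by
      field_simp at h
      linear_combination h
    have := (mul_eq_zero.1 h').resolve_left (sub_ne_zero.2 hn1)
    linarith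
  have : Nontrivial V := Module.nontrivial_of_finrank_pos (R := ℝ) (by omega)
  obtain ⟨v, hv⟩ := exists_ne (0 : V)
  obtain ⟨w₀, hw⟩ : ∃ w, g (I v) w ≠ 0 := by
    by_contra! hc
    have h := hI2 v
    rw [hnd _ hc, map_zero] at h
    exact hv (neg_eq_zero.1 h.symm)
  -- the `J`-average of `R` in either pair of arguments is a multiple of the Kähler form
  have hF : ∀ x y z w, g (R x y z) w + g (R x y (J z)) (J w) = A x y * g (I z) w :=
    fun x y z w => by
      rw [hJ, map_add, LinearMap.add_apply, hgJ, hJ2, map_smul, LinearMap.smul_apply,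
        ← hgJ (I (J z)), hIJ, hJ2]
      simp
  have hav : ∀ x y, (A x y + A (J x) (J y)) * g (I v) w₀
      = (A v w₀ + A (J v) (J w₀)) * g (I x) y := fun x y => by
    linear_combination hF v w₀ x y + hF (J v) (J w₀) x y - hF x y v w₀ - hF (J x) (J y) v w₀
      + hR.pair_symm hg x y v w₀ + hR.pair_symm hg x y (J v) (J w₀)
      + hR.pair_symm hg (J x) (J y) v w₀ + hR.pair_symm hg (J x) (J y) (J v) (J w₀)
  obtain ⟨b, hb⟩ : ∃ b, ∀ x y, A x y + A (J x) (J y) = b * g (I x) y :=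
    ⟨(A v w₀ + A (J v) (J w₀)) / g (I v) w₀, fun x y => by
      have := hav x y
      field_simp
      linarith⟩
  have hric : ∀ x y, ricciForm R x y = -(n * b / 2) * g x y := fun x y => by
    have h := hb x (-I y)
    have e : I (J (I y)) = J y := by rw [hIJ, map_neg, hI2, neg_neg]
    simp only [hA, map_neg, hI2, e, hgI, neg_neg] at h
    rw [show ricciForm R (J x) (-J y) = ricciForm R x y by
      rw [← neg_neg (ricciForm R x y), ← hanti]; simp [ricciForm]] at h
    field_simp at h
    linarith
  exact ⟨_, hric, fun y z => by rw [hA, hric]; ring⟩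

end IsCurvatureLike
end CurvatureAlgebra

/-! ### The Levi-Civita connection of a metric on an open subset of a vector space -/

section LocalConnection

set_option maxSynthPendingDepth 3
set_option synthInstance.maxHeartbeats 100000

open ContinuousLinearMap Filter Topology

variable {E : Type*} [NormedAddCommGroup E] [NormedSpace ℝ E]

/-- Christoffel symbols of the first kind of a metric `G` given in a chart: `christoffelFst G u x y`
is the linear functional `z ↦ G(Γ(x, y), z)`. -/
def christoffelFst (G : E → E →L[ℝ] E →L[ℝ] ℝ) (u : E) : E →L[ℝ] E →L[ℝ] E →L[ℝ] ℝ :=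
  (1 / 2 : ℝ) • (fderiv ℝ G u + (fderiv ℝ G u).flip
    - ((flipₗᵢ ℝ E E ℝ : (E →L[ℝ] E →L[ℝ] ℝ) →L[ℝ] (E →L[ℝ] E →L[ℝ] ℝ)) ∘L (fderiv ℝ G u).flip))

theorem christoffelFst_apply (G : E → E →L[ℝ] E →L[ℝ] ℝ) (u x y z : E) :
    christoffelFst G u x y z
      = (fderiv ℝ G u x y z + fderiv ℝ G u y x z - fderiv ℝ G u z x y) / 2 := by
  simp [christoffelFst]
  ring

/-- Christoffel symbols `Γ(x, y)` of a metric `G` given in a chart, with the index raised by the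
inverse of `G u : E → E*` (which is the junk value `0` where `G u` is degenerate). -/
def christoffel (G : E → E →L[ℝ] E →L[ℝ] ℝ) (u : E) : E →L[ℝ] E →L[ℝ] E :=
  compL ℝ E (E →L[ℝ] ℝ) E (G u).inverse ∘L christoffelFst G u

/-- The covariant derivative `∇_X Y` of a vector field in a chart. -/
def covDeriv (G : E → E →L[ℝ] E →L[ℝ] ℝ) (X Y : E → E) (u : E) : E :=
  fderiv ℝ Y u (X u) + christoffel G u (X u) (Y u)

/-- The covariant derivative `∇_x B` of a field of endomorphisms in a chart. -/
def covDerivEnd (G : E → E →L[ℝ] E →L[ℝ] ℝ) (B : E → E →L[ℝ] E) (u : E) : E →L[ℝ] E →L[ℝ] E :=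
  fderiv ℝ B u + ((compL ℝ E E E).flip (B u) ∘L christoffel G u
    - compL ℝ E E E (B u) ∘L christoffel G u)

theorem covDerivEnd_apply (G : E → E →L[ℝ] E →L[ℝ] ℝ) (B : E → E →L[ℝ] E) (u x : E) :
    covDerivEnd G B u x
      = fderiv ℝ B u x + (christoffel G u x * B u - B u * christoffel G u x) := rfl

/-- The curvature tensor `R(x, y) = ∂_x Γ_y - ∂_y Γ_x + Γ_x Γ_y - Γ_y Γ_x` in a chart. -/
def curvEnd (G : E → E →L[ℝ] E →L[ℝ] ℝ) (u : E) : E →L[ℝ] E →L[ℝ] E →L[ℝ] E :=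
  fderiv ℝ (christoffel G) u - (fderiv ℝ (christoffel G) u).flip
    + ((compL ℝ E E E).bilinearComp (christoffel G u) (christoffel G u)
    - ((compL ℝ E E E).bilinearComp (christoffel G u) (christoffel G u)).flip)

theorem curvEnd_apply (G : E → E →L[ℝ] E →L[ℝ] ℝ) (u x y : E) :
    curvEnd G u x y
      = fderiv ℝ (christoffel G) u x y - fderiv ℝ (christoffel G) u y x
        + (christoffel G u x * christoffel G u y - christoffel G u y * christoffel G u x) := rfl

/-- The curvature tensor in a chart, as a trilinear map. -/
def curvTrilin (G : E → E →L[ℝ] E →L[ℝ] ℝ) (u : E) : E →ₗ[ℝ] E →ₗ[ℝ] E →ₗ[ℝ] E :=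
  LinearMap.mk₂ ℝ (fun x y => (curvEnd G u x y : E →ₗ[ℝ] E))
    (by intros; ext; simp) (by intros; ext; simp) (by intros; ext; simp) (by intros; ext; simp)

@[simp] theorem curvTrilin_apply (G : E → E →L[ℝ] E →L[ℝ] ℝ) (u x y z : E) :
    curvTrilin G u x y z = curvEnd G u x y z := rfl

/-- A smooth pseudo-Riemannian metric on an open subset `U` of a vector space. -/
structure IsMetricOn (U : Set E) (G : E → E →L[ℝ] E →L[ℝ] ℝ) : Prop where
  isOpen : IsOpen U
  contDiffAt {u : E} (hu : u ∈ U) : ContDiffAt ℝ ∞ G u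
  symm {u : E} (hu : u ∈ U) (x y : E) : G u x y = G u y x
  nondeg {u : E} (hu : u ∈ U) (x : E) (h : ∀ y, G u x y = 0) : x = 0

namespace IsMetricOn

variable {U : Set E} {G : E → E →L[ℝ] E →L[ℝ] ℝ} (hG : IsMetricOn U G) {u : E}
include hG

theorem differentiableAt (hu : u ∈ U) : DifferentiableAt ℝ G u :=
  (hG.contDiffAt hu).differentiableAt (by simp)

theorem mem_nhds (hu : u ∈ U) : U ∈ 𝓝 u := hG.isOpen.mem_nhds hu

theorem fderiv_symm (hu : u ∈ U) (x y z : E) : fderiv ℝ G u x y z = fderiv ℝ G u x z y := by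
  have h1 : ∀ y z, fderiv ℝ (fun v => G v y z) u x = fderiv ℝ G u x y z := fun y z => by
    have := hG.differentiableAt hu
    rw [fderiv_clm_apply (by fun_prop) (by fun_prop)]
    simp [fderiv_clm_apply this]
  rw [← h1, ← h1]
  congr 1
  exact Filter.EventuallyEq.fderiv_eq
    (Filter.eventuallyEq_of_mem (hG.mem_nhds hu) fun v hv => hG.symm hv y z)

theorem eq_of_apply (hu : u ∈ U) {x y : E} (h : ∀ z, G u x z = G u y z) : x = y :=
  sub_eq_zero.1 (hG.nondeg hu _ fun z => by simp [h])

/-- The derivative of `G(Y, Z)` in the direction `x`. -/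
theorem fderiv_apply_apply (hu : u ∈ U) {Y Z : E → E} (hY : DifferentiableAt ℝ Y u)
    (hZ : DifferentiableAt ℝ Z u) (x : E) :
    fderiv ℝ (fun v => G v (Y v) (Z v)) u x
      = fderiv ℝ G u x (Y u) (Z u) + G u (fderiv ℝ Y u x) (Z u) + G u (Y u) (fderiv ℝ Z u x) := by
  have h := hG.differentiableAt hu
  rw [fderiv_clm_apply (by fun_prop) hZ]
  simp [fderiv_clm_apply h hY]
  ring

variable [FiniteDimensional ℝ E]

theorem exists_equiv (hu : u ∈ U) : ∃ e : E ≃L[ℝ] (E →L[ℝ] ℝ), (e : E →L[ℝ] E →L[ℝ] ℝ) = G u := by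
  have hinj : Function.Injective (G u : E →ₗ[ℝ] (E →L[ℝ] ℝ)) := by
    rw [← LinearMap.ker_eq_bot, LinearMap.ker_eq_bot']
    intro x hx
    refine hG.nondeg hu x fun v => ?_
    have : G u x = 0 := hx
    rw [this]; rfl
  have hdim : Module.finrank ℝ E = Module.finrank ℝ (E →L[ℝ] ℝ) := by
    rw [← (LinearMap.toContinuousLinearMap (𝕜 := ℝ) (E := E) (F' := ℝ)).finrank_eq]
    exact (Subspace.dual_finrank_eq).symm
  refine ⟨(LinearEquiv.ofInjectiveOfFinrankEq _ hinj hdim).toContinuousLinearEquiv, ?_⟩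
  ext; rfl

theorem apply_inverse (hu : u ∈ U) (f : E →L[ℝ] ℝ) : G u ((G u).inverse f) = f := by
  obtain ⟨e, he⟩ := hG.exists_equiv hu
  rw [← he]
  simp

theorem contDiffAt_christoffel (hu : u ∈ U) : ContDiffAt ℝ ∞ (christoffel G) u := by
  obtain ⟨e, he⟩ := hG.exists_equiv hu
  have h1 : ContDiffAt ℝ ∞ (fun v => (G v).inverse) u := by
    have : ContDiffAt ℝ ∞ ContinuousLinearMap.inverse (G u) := he ▸ contDiffAt_map_inverse e
    exact this.comp u (hG.contDiffAt hu)
  have h2 : ContDiffAt ℝ ∞ (fderiv ℝ G) u := (hG.contDiffAt hu).fderiv_right (by simp)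
  have h3 : ContDiffAt ℝ ∞ (fun v => (fderiv ℝ G v).flip) u :=
    (flipₗᵢ ℝ E E (E →L[ℝ] ℝ)).contDiff.contDiffAt.comp u h2
  have h4 : ContDiffAt ℝ ∞ (christoffelFst G) u :=
    ((h2.add h3).sub (contDiffAt_const.clm_comp h3)).const_smul _
  exact ((compL ℝ E (E →L[ℝ] ℝ) E).contDiff.contDiffAt.comp u h1).clm_comp h4

theorem differentiableAt_christoffel (hu : u ∈ U) : DifferentiableAt ℝ (christoffel G) u :=
  (hG.contDiffAt_christoffel hu).differentiableAt (by simp)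

theorem apply_christoffel (hu : u ∈ U) (x y z : E) : G u (christoffel G u x y) z
    = (fderiv ℝ G u x y z + fderiv ℝ G u y x z - fderiv ℝ G u z x y) / 2 := by
  rw [← christoffelFst_apply]
  exact congrArg (fun f => f z) (hG.apply_inverse hu (christoffelFst G u x y))

theorem christoffel_symm (hu : u ∈ U) (x y : E) : christoffel G u x y = christoffel G u y x :=
  hG.eq_of_apply hu fun z => by
    rw [hG.apply_christoffel hu, hG.apply_christoffel hu, hG.fderiv_symm hu z x y]
    ring

/-- The Levi-Civita connection is metric. -/
theorem fderiv_apply (hu : u ∈ U) (x y z : E) : fderiv ℝ G u x y z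
    = G u (christoffel G u x y) z + G u y (christoffel G u x z) := by
  rw [hG.symm hu y, hG.apply_christoffel hu, hG.apply_christoffel hu, hG.fderiv_symm hu z x y,
    hG.fderiv_symm hu x z y, hG.fderiv_symm hu y x z]
  ring

/-- The Koszul formula in a chart. -/
theorem koszul_formula (hu : u ∈ U) {X Y Z : E → E} (hX : DifferentiableAt ℝ X u)
    (hY : DifferentiableAt ℝ Y u) (hZ : DifferentiableAt ℝ Z u) :
    G u (covDeriv G X Y u) (Z u) =
      (fderiv ℝ (fun v => G v (Y v) (Z v)) u (X u) + fderiv ℝ (fun v => G v (X v) (Z v)) u (Y u)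
        - fderiv ℝ (fun v => G v (X v) (Y v)) u (Z u)
        + G u (VectorField.lieBracket ℝ X Y u) (Z u)
        - G u (VectorField.lieBracket ℝ X Z u) (Y u)
        - G u (VectorField.lieBracket ℝ Y Z u) (X u)) / 2 := by
  rw [hG.fderiv_apply_apply hu hY hZ, hG.fderiv_apply_apply hu hX hZ,
    hG.fderiv_apply_apply hu hX hY]
  simp only [covDeriv, VectorField.lieBracket, map_add, map_sub, add_apply, sub_apply,
    hG.apply_christoffel hu]
  rw [hG.symm hu (X u) (fderiv ℝ Z u (Y u)), hG.symm hu (X u) (fderiv ℝ Y u (Z u)),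
    hG.symm hu (Y u) (fderiv ℝ Z u (X u))]
  ring

/-- In a chart, the curvature of vector fields is given by the tensor `curvEnd`. -/
theorem covDeriv_comm (hu : u ∈ U) {X Y Z : E → E} (hX : DifferentiableAt ℝ X u)
    (hY : DifferentiableAt ℝ Y u) (hZ : ContDiffAt ℝ 2 Z u) :
    covDeriv G X (covDeriv G Y Z) u - covDeriv G Y (covDeriv G X Z) u
      - covDeriv G (VectorField.lieBracket ℝ X Y) Z u = curvEnd G u (X u) (Y u) (Z u) := by
  have hΓ := hG.differentiableAt_christoffel hu
  have hZ1 : DifferentiableAt ℝ Z u := hZ.differentiableAt (by simp)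
  have hZ2 : DifferentiableAt ℝ (fderiv ℝ Z) u :=
    (hZ.fderiv_right (m := 1) (by norm_num)).differentiableAt (by simp)
  have hs : fderiv ℝ (fderiv ℝ Z) u (X u) (Y u) = fderiv ℝ (fderiv ℝ Z) u (Y u) (X u) :=
    (hZ.isSymmSndFDerivAt (by simp)).eq _ _
  have key : ∀ {W : E → E}, DifferentiableAt ℝ W u → ∀ x, fderiv ℝ (covDeriv G W Z) u x
      = fderiv ℝ (fderiv ℝ Z) u x (W u) + fderiv ℝ Z u (fderiv ℝ W u x)
        + (fderiv ℝ (christoffel G) u x (W u) (Z u) + christoffel G u (fderiv ℝ W u x) (Z u)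
        + christoffel G u (W u) (fderiv ℝ Z u x)) := fun {W} hW x => by
    have h1 : DifferentiableAt ℝ (fun v => christoffel G v (W v)) u := hΓ.clm_apply hW
    have e : covDeriv G W Z = (fun v => fderiv ℝ Z v (W v)) +
      (fun v => christoffel G v (W v) (Z v)) := rfl
    rw [e, fderiv_add (hZ2.clm_apply hW) (h1.clm_apply hZ1), fderiv_clm_apply hZ2 hW,
      fderiv_clm_apply h1 hZ1, fderiv_clm_apply hΓ hW]
    simp
    abel
  rw [covDeriv, covDeriv, covDeriv, key hX, key hY, hs, curvEnd_apply]
  simp only [covDeriv, VectorField.lieBracket, map_add, map_sub, add_apply, sub_apply, mul_def, comp_apply]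
  abel

/-- The Ricci identity for a field of endomorphisms in a chart. -/
theorem ricci_identity (hu : u ∈ U) {B : E → E →L[ℝ] E} (hB : ContDiffAt ℝ 2 B u) (x y : E) :
    fderiv ℝ (fun v => covDerivEnd G B v y) u x
      + (christoffel G u x * covDerivEnd G B u y - covDerivEnd G B u y * christoffel G u x)
      - (fderiv ℝ (fun v => covDerivEnd G B v x) u y
      + (christoffel G u y * covDerivEnd G B u x - covDerivEnd G B u x * christoffel G u y))
      = curvEnd G u x y * B u - B u * curvEnd G u x y := by
  have hΓ := hG.differentiableAt_christoffel hu
  have hB1 : DifferentiableAt ℝ B u := hB.differentiableAt (by simp)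
  have hB2 : DifferentiableAt ℝ (fderiv ℝ B) u :=
    (hB.fderiv_right (m := 1) (by norm_num)).differentiableAt (by simp)
  have hs : fderiv ℝ (fderiv ℝ B) u x y = fderiv ℝ (fderiv ℝ B) u y x :=
    (hB.isSymmSndFDerivAt (by simp)).eq _ _
  have key : ∀ x y, fderiv ℝ (fun v => covDerivEnd G B v y) u x
      = fderiv ℝ (fderiv ℝ B) u x y
        + (fderiv ℝ (christoffel G) u x y * B u + christoffel G u y * fderiv ℝ B u x
        - (fderiv ℝ B u x * christoffel G u y + B u * fderiv ℝ (christoffel G) u x y)) :=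
    fun x y => by
      have hΓy : DifferentiableAt ℝ (fun v => christoffel G v y) u := by fun_prop
      have d1 : DifferentiableAt ℝ (fun v => fderiv ℝ B v y) u := by fun_prop
      have d2 : DifferentiableAt ℝ (fun v => christoffel G v y * B v) u := hΓy.mul hB1
      have d3 : DifferentiableAt ℝ (fun v => B v * christoffel G v y) u := hB1.mul hΓy
      simp only [covDerivEnd_apply]
      rw [fderiv_fun_add d1 (d2.fun_sub d3), fderiv_fun_sub d2 d3, fderiv_fun_mul' hΓy hB1, fderiv_fun_mul' hB1 hΓy,
        fderiv_clm_apply hB2 (by fun_prop), fderiv_clm_apply hΓ (by fun_prop)]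
      simp
      abel
  rw [key, key, hs, curvEnd_apply, covDerivEnd_apply, covDerivEnd_apply]
  noncomm_ring

/-- The curvature of a metric has the symmetries of an algebraic curvature tensor: the skewness comes
from the symmetry of the second derivative of `G`, the Bianchi identity from that of `Γ`. -/
theorem isCurvatureLike (hu : u ∈ U) :
    IsCurvatureLike ((coeLM ℝ).comp (G u : E →ₗ[ℝ] E →L[ℝ] ℝ)) (curvTrilin G u) where
  swap x y z := by
    simp only [curvTrilin_apply, curvEnd_apply, add_apply, sub_apply]
    abel
  skew x y z w := by
    have hΓ := hG.differentiableAt_christoffel hu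
    have hs := (((hG.contDiffAt hu).of_le (m := 2) (by norm_cast)).isSymmSndFDerivAt
      (by simp)).eq x y
    have hG2 : DifferentiableAt ℝ (fderiv ℝ G) u :=
      ((hG.contDiffAt hu).fderiv_right (m := 1) (by norm_cast)).differentiableAt (by simp)
    have key : ∀ x y, fderiv ℝ (fderiv ℝ G) u x y z w
        = fderiv ℝ G u x (christoffel G u y z) w + G u (fderiv ℝ (christoffel G) u x y z) w
          + (fderiv ℝ G u x z (christoffel G u y w)
          + G u z (fderiv ℝ (christoffel G) u x y w)) := fun x y => by
      have e1 : fderiv ℝ (fun v => fderiv ℝ G v y z w) u x = fderiv ℝ (fderiv ℝ G) u x y z w := by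
        rw [fderiv_clm_apply (by fun_prop) (by fun_prop),
          fderiv_clm_apply (by fun_prop) (by fun_prop), fderiv_clm_apply hG2 (by fun_prop)]
        simp
      have e2 : (fun v => fderiv ℝ G v y z w) =ᶠ[𝓝 u] fun v =>
          G v (christoffel G v y z) w + G v z (christoffel G v y w) :=
        Filter.eventuallyEq_of_mem (hG.mem_nhds hu) fun v hv => hG.fderiv_apply hv y z w
      have e3 : ∀ z, fderiv ℝ (fun v => christoffel G v y z) u x
          = fderiv ℝ (christoffel G) u x y z := fun z => by
        rw [fderiv_clm_apply (by fun_prop) (by fun_prop), fderiv_clm_apply hΓ (by fun_prop)]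
        simp
      have := hG.differentiableAt hu
      rw [← e1, e2.fderiv_eq, fderiv_fun_add (by fun_prop) (by fun_prop)]
      simp only [add_apply]
      rw [hG.fderiv_apply_apply hu (by fun_prop) (by fun_prop),
        hG.fderiv_apply_apply hu (by fun_prop) (by fun_prop), e3, e3]
      simp
    have h := congrArg (fun f => f z w) hs
    simp only [key, hG.fderiv_apply hu] at h
    simp only [LinearMap.comp_apply, coe_coe, coeLM_apply, curvTrilin_apply, curvEnd_apply,
      add_apply, sub_apply, map_add, map_sub, mul_def, comp_apply,
      LinearMap.add_apply, LinearMap.sub_apply]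
    linarith
  bianchi x y z := by
    have hΓ := hG.differentiableAt_christoffel hu
    have key : ∀ x y z, fderiv ℝ (christoffel G) u x y z = fderiv ℝ (christoffel G) u x z y :=
      fun x y z => by
        have e3 : ∀ y z, fderiv ℝ (fun v => christoffel G v y z) u x
            = fderiv ℝ (christoffel G) u x y z := fun y z => by
          rw [fderiv_clm_apply (by fun_prop) (by fun_prop), fderiv_clm_apply hΓ (by fun_prop)]
          simp
        rw [← e3, ← e3]
        congr 1
        exact Filter.EventuallyEq.fderiv_eq (Filter.eventuallyEq_of_mem (hG.mem_nhds hu)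
          fun v hv => hG.christoffel_symm hv y z)
    simp only [curvTrilin_apply, curvEnd_apply, add_apply, sub_apply, mul_def, comp_apply]
    rw [key x y z, key y z x, key z x y, hG.christoffel_symm hu x y, hG.christoffel_symm hu y z,
      hG.christoffel_symm hu z x]
    abel

end IsMetricOn
end LocalConnection

/-! ### The quaternionic Kähler condition on an open subset of a vector space -/

section LocalNH

open ContinuousLinearMap Filter Topology

set_option maxSynthPendingDepth 3
set_option synthInstance.maxHeartbeats 100000

/-- A linear form `α` with `α ∧ F = 0` for the nondegenerate 2-form `F = g(I·, ·)` vanishes in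
dimension greater than `2`: contract with the inverse of `F`. -/
theorem eq_zero_of_wedge_eq_zero {V : Type*} [AddCommGroup V] [Module ℝ V] [FiniteDimensional ℝ V]
    {g : V →ₗ[ℝ] V →ₗ[ℝ] ℝ} (hg : ∀ u v, g u v = g v u) (hnd : ∀ u, (∀ v, g u v = 0) → u = 0)
    (hdim : 2 < Module.finrank ℝ V) {I : V →ₗ[ℝ] V} (hI2 : ∀ x, I (I x) = -x)
    (hgI : ∀ x y, g (I x) y = -g x (I y)) {α : V →ₗ[ℝ] ℝ}
    (h : ∀ x y z, α x * g (I y) z + α y * g (I z) x + α z * g (I x) y = 0) : α = 0 := by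
  have hinj : Function.Injective g := by
    rw [← LinearMap.ker_eq_bot, LinearMap.ker_eq_bot']
    intro u hu
    exact hnd u fun v => by rw [hu]; rfl
  obtain ⟨a, rfl⟩ : ∃ a, g a = α :=
    (LinearMap.injective_iff_surjective_of_finrank_eq_finrank
      (Subspace.dual_finrank_eq (K := ℝ) (V := V)).symm).1 hinj α
  ext x
  have h1 : -(g a x • LinearMap.id) + (g a).smulRight x + (g (I x)).smulRight (I a) = 0 := by
    ext y
    have h2 : g a x • I y - g a y • I x + g (I x) y • a = 0 := hnd _ fun z => by
      have := h x y z
      rw [hgI z, hg z] at this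
      simp only [map_add, map_sub, map_smul, LinearMap.add_apply, LinearMap.sub_apply,
        LinearMap.smul_apply, smul_eq_mul]
      linarith
    have h3 := congrArg I h2
    simpa [hI2] using h3
  have h2 := congrArg (LinearMap.trace ℝ V) h1
  have h3 : g (I x) (I a) = g a x := by rw [hgI, hI2, hg a]; simp
  simp only [map_add, map_neg, map_smul, LinearMap.trace_id, LinearMap.trace_smulRight,
    h3, map_zero, smul_eq_mul] at h2
  have h4 : ((Module.finrank ℝ V : ℝ) - 2) * g a x = 0 := by linarith
  have h5 : (2 : ℝ) < Module.finrank ℝ V := by exact_mod_cast hdim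
  simpa using (mul_eq_zero.1 h4).resolve_left (by linarith)

variable {E : Type*} [NormedAddCommGroup E] [NormedSpace ℝ E]

theorem covDerivEnd_congr {G : E → E →L[ℝ] E →L[ℝ] ℝ} {B C : E → E →L[ℝ] E} {u : E}
    (h : B =ᶠ[𝓝 u] C) : covDerivEnd G B u = covDerivEnd G C u := by
  rw [covDerivEnd, covDerivEnd, h.fderiv_eq, h.eq_of_nhds]

theorem covDerivEnd_mul (G : E → E →L[ℝ] E →L[ℝ] ℝ) {B C : E → E →L[ℝ] E} {u : E}
    (hB : DifferentiableAt ℝ B u) (hC : DifferentiableAt ℝ C u) (x : E) :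
    covDerivEnd G (fun v => B v * C v) u x
      = covDerivEnd G B u x * C u + B u * covDerivEnd G C u x := by
  simp only [covDerivEnd_apply]
  rw [fderiv_fun_mul' hB hC]
  simp
  noncomm_ring

theorem covDerivEnd_neg_one (G : E → E →L[ℝ] E →L[ℝ] ℝ) (u x : E) :
    covDerivEnd G (fun _ => -1) u x = 0 := by
  simp [covDerivEnd_apply]

/-- An almost hypercomplex structure with an NH-metric on an open subset `U` of a vector space,
satisfying the quaternionic Kähler condition. -/
structure IsQuaternionicKahlerOn (U : Set E) (G : E → E →L[ℝ] E →L[ℝ] ℝ)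
    (J : Fin 3 → E → E →L[ℝ] E) : Prop extends IsMetricOn U G where
  contDiffAt_J (a : Fin 3) {u : E} (hu : u ∈ U) : ContDiffAt ℝ ∞ (J a) u
  sq (a : Fin 3) {u : E} (hu : u ∈ U) : J a u * J a u = -1
  mul (a : Fin 3) {u : E} (hu : u ∈ U) : J a u = J (a + 1) u * J (a + 2) u
  mul' (a : Fin 3) {u : E} (hu : u ∈ U) : J a u = -(J (a + 2) u * J (a + 1) u)
  compatible (a : Fin 3) {u : E} (hu : u ∈ U) (x y : E) :
    G u x y = sgn a * G u (J a u x) (J a u y)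
  parallel (a : Fin 3) {u : E} (hu : u ∈ U) (x : E) :
    ∃ c : Fin 3 → ℝ, covDerivEnd G (J a) u x = ∑ b, c b • J b u

/-- The covariant derivative of a field of self-adjoint (`s = 1`) or skew (`s = -1`) endomorphisms is
of the same kind. -/
theorem IsMetricOn.covDerivEnd_adjoint [FiniteDimensional ℝ E] {U : Set E}
    {G : E → E →L[ℝ] E →L[ℝ] ℝ} (hG : IsMetricOn U G)
    {u : E} (hu : u ∈ U) {B : E → E →L[ℝ] E} (hB : DifferentiableAt ℝ B u) {s : ℝ}
    (h : ∀ v ∈ U, ∀ y z, G v (B v y) z = s * G v y (B v z)) (x y z : E) :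
    G u (covDerivEnd G B u x y) z = s * G u y (covDerivEnd G B u x z) := by
  have h1 : fderiv ℝ (fun v => G v (B v y) z) u x = fderiv ℝ (fun v => s * G v y (B v z)) u x := by
    congr 1
    exact EventuallyEq.fderiv_eq (eventuallyEq_of_mem (hG.mem_nhds hu) fun v hv => h v hv y z)
  have hGd := hG.differentiableAt hu
  rw [fderiv_const_mul (by fun_prop)] at h1
  simp only [smul_apply, smul_eq_mul] at h1
  rw [hG.fderiv_apply_apply hu (by fun_prop) (by fun_prop),
    hG.fderiv_apply_apply hu (by fun_prop) (by fun_prop)] at h1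
  simp [fderiv_clm_apply hB, hG.fderiv_apply hu] at h1
  simp only [covDerivEnd_apply, add_apply, sub_apply, mul_def, comp_apply, map_add, map_sub]
  have h2 := h u hu y (christoffel G u x z)
  have h3 := h u hu (christoffel G u x y) z
  linear_combination h1 - h2 - h3

/-- The 1-form `ω` with `∇ J_2 = ω J_3` (for the indices `1, 2, 3`, which are `0, 1, 2 : Fin 3`). It is
written as a trace, `ω(x) = - tr (J_3 ∘ ∇_x J_2) / dim`, which makes its smoothness evident. -/
def connectionForm [FiniteDimensional ℝ E] (G : E → E →L[ℝ] E →L[ℝ] ℝ)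
    (J : Fin 3 → E → E →L[ℝ] E) (u : E) : E →L[ℝ] ℝ :=
  (-(1 / Module.finrank ℝ E : ℝ)) •
    (LinearMap.toContinuousLinearMap ((LinearMap.trace ℝ E).comp (coeLM ℝ)) ∘L
      compL ℝ E E E (J 2 u) ∘L covDerivEnd G (J 1) u)

/-- The exterior derivative `(x, y) ↦ dω(x, y)` of the connection form, without a factor `1 / 2`. -/
def connectionCurv [FiniteDimensional ℝ E] (G : E → E →L[ℝ] E →L[ℝ] ℝ)
    (J : Fin 3 → E → E →L[ℝ] E) (u : E) : E →L[ℝ] E →L[ℝ] ℝ :=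
  fderiv ℝ (connectionForm G J) u - (fderiv ℝ (connectionForm G J) u).flip

namespace IsQuaternionicKahlerOn

variable {U : Set E} {G : E → E →L[ℝ] E →L[ℝ] ℝ} {J : Fin 3 → E → E →L[ℝ] E}
  (h : IsQuaternionicKahlerOn U G J) {u : E}
include h

theorem differentiableAt_J (a : Fin 3) (hu : u ∈ U) : DifferentiableAt ℝ (J a) u :=
  (h.contDiffAt_J a hu).differentiableAt (by simp)

theorem sq_apply (a : Fin 3) (hu : u ∈ U) (x : E) : J a u (J a u x) = -x :=
  congrArg (fun f => f x) (h.sq a hu)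

theorem adjoint (a : Fin 3) (hu : u ∈ U) (x y : E) : G u (J a u x) y = -sgn a * G u x (J a u y) := by
  rw [h.compatible a hu, h.sq_apply a hu]
  simp

theorem covDerivEnd_anticomm (a : Fin 3) (hu : u ∈ U) (x : E) :
    covDerivEnd G (J a) u x * J a u + J a u * covDerivEnd G (J a) u x = 0 := by
  rw [← covDerivEnd_mul G (h.differentiableAt_J a hu) (h.differentiableAt_J a hu),
    covDerivEnd_congr (eventuallyEq_of_mem (h.mem_nhds hu) fun v hv => h.sq a hv),
    covDerivEnd_neg_one]

/-- `∇_x J_α` has no `J_α`-component, since it anticommutes with `J_α`. -/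
theorem exists_covDerivEnd_eq [Nontrivial E] (a : Fin 3) (hu : u ∈ U) (x : E) :
    ∃ b c : ℝ, covDerivEnd G (J a) u x = b • J (a + 1) u + c • J (a + 2) u := by
  obtain ⟨c, hc⟩ := h.parallel a hu x
  have hsum : ∑ b, c b • J b u = c a • J a u + (c (a + 1) • J (a + 1) u + c (a + 2) • J (a + 2) u) := by
    fin_cases a <;> simp [Fin.sum_univ_three] <;> abel
  rw [hsum] at hc
  have h0 := h.covDerivEnd_anticomm a hu x
  have e1 : J (a + 1) u * J a u = -(J a u * J (a + 1) u) := by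
    have m1 := h.mul (a + 2) hu
    have m2 := h.mul' (a + 2) hu
    rw [show a + 2 + 1 = a by fin_cases a <;> rfl, show a + 2 + 2 = a + 1 by fin_cases a <;> rfl]
      at m1 m2
    rw [← m1, m2, neg_neg]
  have e2 : J (a + 2) u * J a u = -(J a u * J (a + 2) u) := by
    have m1 := h.mul (a + 1) hu
    have m2 := h.mul' (a + 1) hu
    rw [show a + 1 + 1 = a + 2 by fin_cases a <;> rfl, show a + 1 + 2 = a by fin_cases a <;> rfl]
      at m1 m2
    exact m1.symm.trans m2
  have h1 : (2 * c a) • (1 : E →L[ℝ] E) = 0 := by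
    rw [hc] at h0
    simp only [add_mul, mul_add, smul_mul_assoc, mul_smul_comm, h.sq a hu, e1, e2] at h0
    rw [← neg_eq_zero, ← h0]
    module
  have h2 : c a = 0 := by simpa using h1
  exact ⟨_, _, by rw [hc, h2, zero_smul, zero_add]⟩

variable [FiniteDimensional ℝ E]

theorem covDerivEnd_adjoint' (a : Fin 3) (hu : u ∈ U) (x y z : E) :
    G u (covDerivEnd G (J a) u x y) z = -sgn a * G u y (covDerivEnd G (J a) u x z) :=
  h.covDerivEnd_adjoint hu (h.differentiableAt_J a hu) (fun _ hv y z => h.adjoint a hv y z) x y z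

/-- `J_1` is parallel: `∇_x J_1` is skew, but a combination of the self-adjoint `J_2` and `J_3`. -/
theorem covDerivEnd_zero [Nontrivial E] (hu : u ∈ U) : covDerivEnd G (J 0) u = 0 := by
  ext x y
  obtain ⟨b, c, hbc⟩ := h.exists_covDerivEnd_eq 0 hu x
  refine h.nondeg hu _ fun z => ?_
  have h1 := h.covDerivEnd_adjoint' 0 hu x y z
  have a1 := h.adjoint 1 hu y z
  have a2 := h.adjoint 2 hu y z
  rw [hbc] at h1 ⊢
  simp [sgn] at h1 a1 a2 ⊢
  rw [a1, a2] at h1 ⊢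
  linarith

theorem covDerivEnd_one [Nontrivial E] (hu : u ∈ U) (x : E) :
    covDerivEnd G (J 1) u x = connectionForm G J u x • J 2 u := by
  obtain ⟨c, b, hbc⟩ := h.exists_covDerivEnd_eq 1 hu x
  simp only [show (1 + 1 : Fin 3) = 2 from rfl, show (1 + 2 : Fin 3) = 0 from rfl] at hbc
  -- the component along the skew `J_1` vanishes since `∇_x J_2` is self-adjoint
  have hb : b • J 0 u = 0 := by
    ext y
    refine h.nondeg hu _ fun z => ?_
    have h1 := h.covDerivEnd_adjoint' 1 hu x y z
    have a1 := h.adjoint 0 hu y z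
    have a2 := h.adjoint 2 hu y z
    rw [hbc] at h1
    simp [sgn] at h1 a1 a2
    rw [a1, a2] at h1
    rw [smul_apply, map_smul, smul_apply, smul_eq_mul, a1]
    linarith
  rw [hb, add_zero] at hbc
  have hd : (Module.finrank ℝ E : ℝ) ≠ 0 := by
    exact_mod_cast Module.finrank_pos.ne'
  have : connectionForm G J u x = c := by
    have e : (coeLM ℝ : (E →L[ℝ] E) →ₗ[ℝ] E →ₗ[ℝ] E) (compL ℝ E E E (J 2 u) (c • J 2 u))
        = (-c) • LinearMap.id := by
      ext y
      simp [h.sq_apply 2 hu]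
    simp only [connectionForm, smul_apply, comp_apply, hbc, LinearMap.coe_toContinuousLinearMap',
      LinearMap.comp_apply]
    rw [e, map_smul, LinearMap.trace_id]
    simp
    field_simp
  rw [hbc, this]

theorem covDerivEnd_two [Nontrivial E] (hu : u ∈ U) (x : E) :
    covDerivEnd G (J 2) u x = -(connectionForm G J u x • J 1 u) := by
  rw [covDerivEnd_congr (eventuallyEq_of_mem (h.mem_nhds hu) fun v hv => h.mul 2 hv)]
  refine (covDerivEnd_mul G (h.differentiableAt_J 0 hu) (h.differentiableAt_J 1 hu) x).trans ?_
  rw [h.covDerivEnd_zero hu, h.covDerivEnd_one hu, h.mul' 1 hu]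
  simp

theorem contDiffAt_connectionForm (hu : u ∈ U) : ContDiffAt ℝ ∞ (connectionForm G J) u := by
  have hΓ := h.contDiffAt_christoffel hu
  have h1 := h.contDiffAt_J 1 hu
  have h2 : ContDiffAt ℝ ∞ (covDerivEnd G (J 1)) u :=
    (h1.fderiv_right (by simp)).add
      ((((compL ℝ E E E).flip.contDiff.contDiffAt.comp u h1).clm_comp hΓ).sub
        (((compL ℝ E E E).contDiff.contDiffAt.comp u h1).clm_comp hΓ))
  exact ((contDiffAt_const.clm_comp
    (((compL ℝ E E E).contDiff.contDiffAt.comp u (h.contDiffAt_J 2 hu)).clm_comp h2)).const_smul _)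

theorem curvEnd_comm_zero [Nontrivial E] (hu : u ∈ U) (x y : E) :
    curvEnd G u x y * J 0 u - J 0 u * curvEnd G u x y = 0 := by
  have hz : ∀ y, (fun v => covDerivEnd G (J 0) v y) =ᶠ[𝓝 u] fun _ => 0 := fun y =>
    eventuallyEq_of_mem (h.mem_nhds hu) fun v hv => by simp [h.covDerivEnd_zero hv]
  rw [← h.ricci_identity hu ((h.contDiffAt_J 0 hu).of_le (by norm_cast)) x y, (hz x).fderiv_eq,
    (hz y).fderiv_eq, h.covDerivEnd_zero hu]
  simp

theorem curvEnd_comm_one [Nontrivial E] (hu : u ∈ U) (x y : E) :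
    curvEnd G u x y * J 1 u - J 1 u * curvEnd G u x y = connectionCurv G J u x y • J 2 u := by
  have hω : DifferentiableAt ℝ (connectionForm G J) u :=
    (h.contDiffAt_connectionForm hu).differentiableAt (by simp)
  have hz : ∀ y, (fun v => covDerivEnd G (J 1) v y) =ᶠ[𝓝 u]
      fun v => connectionForm G J v y • J 2 v := fun y =>
    eventuallyEq_of_mem (h.mem_nhds hu) fun v hv => h.covDerivEnd_one hv y
  have hd : ∀ x y, fderiv ℝ (fun v => connectionForm G J v y • J 2 v) u x
      = connectionForm G J u y • fderiv ℝ (J 2) u x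
        + fderiv ℝ (connectionForm G J) u x y • J 2 u := fun x y => by
    rw [fderiv_fun_smul (by fun_prop) (h.differentiableAt_J 2 hu),
      fderiv_clm_apply hω (by fun_prop)]
    simp
  have h2 : ∀ x, fderiv ℝ (J 2) u x = -(connectionForm G J u x • J 1 u)
      - (christoffel G u x * J 2 u - J 2 u * christoffel G u x) := fun x => by
    rw [← h.covDerivEnd_two hu, covDerivEnd_apply]
    abel
  rw [← h.ricci_identity hu ((h.contDiffAt_J 1 hu).of_le (by norm_cast)) x y, (hz x).fderiv_eq,
    (hz y).fderiv_eq, hd, hd, h2, h2, h.covDerivEnd_one hu, h.covDerivEnd_one hu]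
  simp only [connectionCurv, sub_apply, flip_apply, smul_mul_assoc, mul_smul_comm]
  module

/-- The Einstein condition at a point, together with the proportionality of `dω` and the Kähler
form. -/
theorem exists_einstein {n : ℕ} (hn : 2 ≤ n) (hdim : Module.finrank ℝ E = 4 * n) (hu : u ∈ U) :
    ∃ c : ℝ, (∀ y z, ricciForm (curvTrilin G u) y z = c * G u y z) ∧
      ∀ y z, connectionCurv G J u y z = c / n * G u y (J 0 u z) := by
  have : Nontrivial E := Module.nontrivial_of_finrank_pos (R := ℝ) (by omega)
  have anti : ∀ x, J 1 u (J 0 u x) = -J 0 u (J 1 u x) := fun x => by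
    have h1 := congrArg (fun f => f x) (h.mul 2 hu)
    have h2 := congrArg (fun f => f x) (h.mul' 2 hu)
    simp only [mul_def, comp_apply, neg_apply] at h1 h2
    rw [h2] at h1
    simpa using congrArg Neg.neg h1
  have := (h.isCurvatureLike hu).exists_ricciForm_eq_smul (h.symm hu) (h.nondeg hu) hn hdim
    (I := J 0 u) (J := J 1 u) (h.sq_apply 0 hu) (h.sq_apply 1 hu) anti
    (fun x y => by simpa [sgn] using h.adjoint 0 hu x y)
    (fun x y => by simpa [sgn] using h.adjoint 1 hu x y)
    (fun x y z => by
      have := congrArg (fun f => f z) (h.curvEnd_comm_zero hu x y)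
      exact sub_eq_zero.1 this)
    (A := (coeLM ℝ).comp (connectionCurv G J u : E →ₗ[ℝ] E →L[ℝ] ℝ))
    (fun x y z => by
      have := congrArg (fun f => f z) (h.curvEnd_comm_one hu x y)
      rw [h.mul 2 hu] at this
      exact (sub_eq_iff_eq_add'.1 this))
  exact this

/-- The Kähler form `G(J_1 ·, ·)` is parallel. -/
theorem fderiv_kahlerForm [Nontrivial E] (hu : u ∈ U) (x y z : E) :
    fderiv ℝ (fun v => G v (J 0 v y) z) u x
      = G u (J 0 u (christoffel G u x y)) z + G u (J 0 u y) (christoffel G u x z) := by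
  have hJ := h.differentiableAt_J 0 hu
  have h0 : fderiv ℝ (J 0) u x y
      = J 0 u (christoffel G u x y) - christoffel G u x (J 0 u y) := by
    have := congrArg (fun f => f x y) (h.covDerivEnd_zero hu)
    simp only [covDerivEnd_apply, add_apply, sub_apply, mul_def, comp_apply, zero_apply] at this
    rw [← sub_eq_zero, ← this]
    abel
  rw [h.fderiv_apply_apply hu (by fun_prop) (by fun_prop), fderiv_clm_apply hJ (by fun_prop),
    h.fderiv_apply hu]
  simp [h0]
  ring

/-- The Einstein factor `c` has zero derivative: `n dω = -c F`, and both `dω` and the Kähler form `F`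
are closed, so `dc ∧ F = 0`. -/
theorem hasFDerivAt_einstein {n : ℕ} (hn : 2 ≤ n) (hdim : Module.finrank ℝ E = 4 * n)
    {c : E → ℝ} (hc : ∀ v ∈ U, ∀ y z, ricciForm (curvTrilin G v) y z = c v * G v y z)
    (hu : u ∈ U) : HasFDerivAt c (0 : E →L[ℝ] ℝ) u := by
  have hn0 : (n : ℝ) ≠ 0 := by positivity
  have : Nontrivial E := Module.nontrivial_of_finrank_pos (R := ℝ) (by omega)
  obtain ⟨e, he⟩ := exists_ne (0 : E)
  have hex : ∀ v ∈ U, ∀ x, x ≠ 0 → ∃ w, G v x w ≠ 0 := fun v hv x hx => by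
    by_contra! hcon
    exact hx (h.nondeg hv x hcon)
  have hskew : ∀ v ∈ U, ∀ y z, G v (J 0 v y) z = -G v y (J 0 v z) := fun v hv y z => by
    simpa [sgn] using h.adjoint 0 hv y z
  have hA : ∀ v ∈ U, ∀ y z, n * connectionCurv G J v y z = -(c v * G v (J 0 v y) z) :=
    fun v hv y z => by
      obtain ⟨c', h1, h2⟩ := h.exists_einstein hn hdim hv
      obtain ⟨w, hw⟩ := hex v hv e he
      have : c' = c v := mul_right_cancel₀ hw ((h1 e w).symm.trans (hc v hv e w))
      rw [h2, this, hskew v hv]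
      field_simp
  have hω : ContDiffAt ℝ ∞ (connectionForm G J) u := h.contDiffAt_connectionForm hu
  have hω2 : DifferentiableAt ℝ (fderiv ℝ (connectionForm G J)) u :=
    (hω.fderiv_right (m := 1) (by norm_cast)).differentiableAt (by simp)
  have hs := (hω.of_le (m := 2) (by norm_cast)).isSymmSndFDerivAt (by simp)
  have hAv : ∀ v y z, connectionCurv G J v y z
      = fderiv ℝ (connectionForm G J) v y z - fderiv ℝ (connectionForm G J) v z y :=
    fun v y z => rfl
  have hAd : ∀ y z, DifferentiableAt ℝ (fun v => connectionCurv G J v y z) u := fun y z => by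
    simp only [hAv]
    fun_prop
  have hGd := h.differentiableAt hu
  have hJd := h.differentiableAt_J 0 hu
  have hFd : ∀ y z, DifferentiableAt ℝ (fun v => G v (J 0 v y) z) u := fun y z => by fun_prop
  -- `c` is differentiable as a quotient of differentiable functions
  have hcd : DifferentiableAt ℝ c u := by
    have he' : J 0 u e ≠ 0 := fun h0 => he (by simpa [h0] using (h.sq_apply 0 hu e).symm)
    obtain ⟨w, hw⟩ := hex u hu _ he'
    have hev : c =ᶠ[𝓝 u] fun v => -(n * connectionCurv G J v e w) / G v (J 0 v e) w := by
      filter_upwards [h.mem_nhds hu, (hFd e w).continuousAt.eventually_ne hw] with v hv hvw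
      rw [hA v hv]
      field_simp
    refine DifferentiableAt.congr_of_eventuallyEq ?_ hev
    simp only [div_eq_mul_inv]
    exact ((hAd e w).const_mul _).fun_neg.fun_mul ((hFd e w).fun_inv hw)
  have hAf : ∀ x y z, fderiv ℝ (fun v => connectionCurv G J v y z) u x
      = fderiv ℝ (fderiv ℝ (connectionForm G J)) u x y z
        - fderiv ℝ (fderiv ℝ (connectionForm G J)) u x z y := fun x y z => by
    have hd1 : ∀ y z, fderiv ℝ (fun v => fderiv ℝ (connectionForm G J) v y z) u x
        = fderiv ℝ (fderiv ℝ (connectionForm G J)) u x y z := fun y z => by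
      rw [fderiv_clm_apply (by fun_prop) (by fun_prop), fderiv_clm_apply hω2 (by fun_prop)]
      simp
    simp only [hAv]
    rw [fderiv_fun_sub (by fun_prop) (by fun_prop), sub_apply, hd1, hd1]
  have hprod : ∀ x y z, n * fderiv ℝ (fun v => connectionCurv G J v y z) u x
      = -(c u * (G u (J 0 u (christoffel G u x y)) z + G u (J 0 u y) (christoffel G u x z))
        + fderiv ℝ c u x * G u (J 0 u y) z) := fun x y z => by
    have h1 : (fun v => n * connectionCurv G J v y z) =ᶠ[𝓝 u]
        fun v => -(c v * G v (J 0 v y) z) :=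
      eventuallyEq_of_mem (h.mem_nhds hu) fun v hv => hA v hv y z
    have h2 := DFunLike.congr_fun (h1.fderiv_eq (𝕜 := ℝ)) x
    rw [fderiv_const_mul (hAd y z), fderiv_fun_neg, fderiv_fun_mul hcd (hFd y z)] at h2
    simp only [smul_apply, neg_apply, add_apply, smul_eq_mul, h.fderiv_kahlerForm hu] at h2
    linarith
  -- the cyclic sum of `hprod` is the exterior derivative of `n dω = -c F`
  have hzero : (fderiv ℝ c u : E →ₗ[ℝ] ℝ) = 0 := by
    refine eq_zero_of_wedge_eq_zero (g := (coeLM ℝ).comp (G u : E →ₗ[ℝ] E →L[ℝ] ℝ))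
      (h.symm hu) (h.nondeg hu) (by omega) (I := J 0 u) (h.sq_apply 0 hu) (hskew u hu)
      fun x y z => ?_
    change fderiv ℝ c u x * G u (J 0 u y) z + fderiv ℝ c u y * G u (J 0 u z) x
      + fderiv ℝ c u z * G u (J 0 u x) y = 0
    have p1 := hprod x y z
    have p2 := hprod y z x
    have p3 := hprod z x y
    rw [hAf] at p1 p2 p3
    have s1 := DFunLike.congr_fun (hs.eq x y) z
    have s2 := DFunLike.congr_fun (hs.eq y z) x
    have s3 := DFunLike.congr_fun (hs.eq z x) y
    have k : ∀ y z, G u (J 0 u y) z = -G u (J 0 u z) y := fun y z => by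
      rw [hskew u hu, h.symm hu]
    rw [k y] at p1
    rw [k z, h.christoffel_symm hu y x] at p2
    rw [k x (christoffel G u z y), h.christoffel_symm hu z x, h.christoffel_symm hu z y] at p3
    linear_combination p1 + p2 + p3 - n * (s1 + s2 + s3)
  have : fderiv ℝ c u = 0 := by
    ext x
    exact congrArg (fun f => f x) hzero
  exact this ▸ hcd.hasFDerivAt

end IsQuaternionicKahlerOn
end LocalNH

/-! ### Components of tensor fields in a chart -/

section Charts

open ContinuousLinearMap Filter Topology Set

variable {m : ℕ} {M : Type*} [TopologicalSpace M] [ChartedSpace (EuclideanSpace ℝ (Fin m)) M]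

/-- The isomorphism from the model space to the tangent space at the point with coordinates `u` in
the preferred chart at `p₀`, given by the coordinate vectors of that chart. -/
def toTangent (p₀ : M) (u : EuclideanSpace ℝ (Fin m)) :
    EuclideanSpace ℝ (Fin m) →L[ℝ] TangentSpace (𝓡 m) ((extChartAt (𝓡 m) p₀).symm u) :=
  mfderiv (𝓡 m) (𝓡 m) (extChartAt (𝓡 m) p₀).symm u

/-- The inverse of `toTangent`: the components of tangent vectors in the chart at `p₀`. -/
def ofTangent (p₀ : M) (u : EuclideanSpace ℝ (Fin m)) :
    TangentSpace (𝓡 m) ((extChartAt (𝓡 m) p₀).symm u) →L[ℝ] EuclideanSpace ℝ (Fin m) :=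
  (toTangent p₀ u).inverse

/-- The components of a vector field in the chart at `p₀`. -/
def hat (p₀ : M) (X : VField m M) (u : EuclideanSpace ℝ (Fin m)) : EuclideanSpace ℝ (Fin m) :=
  ofTangent p₀ u (X ((extChartAt (𝓡 m) p₀).symm u))

/-- The components of a field of endomorphisms in the chart at `p₀`. -/
def hatEnd (p₀ : M) (A : (p : M) → TangentSpace (𝓡 m) p →L[ℝ] TangentSpace (𝓡 m) p)
    (u : EuclideanSpace ℝ (Fin m)) : EuclideanSpace ℝ (Fin m) →L[ℝ] EuclideanSpace ℝ (Fin m) :=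
  ofTangent p₀ u ∘L A ((extChartAt (𝓡 m) p₀).symm u) ∘L toTangent p₀ u

variable {p₀ : M} {u : EuclideanSpace ℝ (Fin m)}

theorem mem_chart_source (hu : u ∈ (extChartAt (𝓡 m) p₀).target) :
    (extChartAt (𝓡 m) p₀).symm u ∈ (chartAt (EuclideanSpace ℝ (Fin m)) p₀).source := by
  rw [← extChartAt_source (𝓡 m)]
  exact (extChartAt (𝓡 m) p₀).map_target hu

variable [IsManifold (𝓡 m) ∞ M]

theorem isInvertible_toTangent (hu : u ∈ (extChartAt (𝓡 m) p₀).target) :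
    (toTangent p₀ u).IsInvertible := by
  have : IsManifold (𝓡 m) 1 M := IsManifold.of_le (n := ∞) (by norm_cast)
  have h := isInvertible_mfderivWithin_extChartAt_symm (I := 𝓡 m) hu
  rwa [show range (𝓡 m) = univ from (𝓡 m).range_eq_univ, mfderivWithin_univ] at h

theorem toTangent_ofTangent (hu : u ∈ (extChartAt (𝓡 m) p₀).target)
    (w : TangentSpace (𝓡 m) ((extChartAt (𝓡 m) p₀).symm u)) :
    toTangent p₀ u (ofTangent p₀ u w) = w :=
  (isInvertible_toTangent hu).self_apply_inverse w

theorem ofTangent_toTangent (hu : u ∈ (extChartAt (𝓡 m) p₀).target)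
    (v : EuclideanSpace ℝ (Fin m)) : ofTangent p₀ u (toTangent p₀ u v) = v :=
  (isInvertible_toTangent hu).inverse_apply_self v

theorem toTangent_hat (hu : u ∈ (extChartAt (𝓡 m) p₀).target) (X : VField m M) :
    toTangent p₀ u (hat p₀ X u) = X ((extChartAt (𝓡 m) p₀).symm u) :=
  toTangent_ofTangent hu _

theorem contMDiffAt_symm (hu : u ∈ (extChartAt (𝓡 m) p₀).target) :
    ContMDiffAt (𝓡 m) (𝓡 m) ∞ (extChartAt (𝓡 m) p₀).symm u :=
  (contMDiffOn_extChartAt_symm p₀).contMDiffAt ((isOpen_extChartAt_target p₀).mem_nhds hu)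

theorem toTangent_eq_symmL (hu : u ∈ (extChartAt (𝓡 m) p₀).target) :
    toTangent p₀ u = (trivializationAt (EuclideanSpace ℝ (Fin m)) (TangentSpace (𝓡 m)) p₀).symmL ℝ
      ((extChartAt (𝓡 m) p₀).symm u) := by
  have : IsManifold (𝓡 m) 1 M := IsManifold.of_le (n := ∞) (by norm_cast)
  rw [TangentBundle.symmL_trivializationAt (mem_chart_source hu),
    show range (𝓡 m) = univ from (𝓡 m).range_eq_univ, mfderivWithin_univ,
    (extChartAt (𝓡 m) p₀).right_inv hu]
  rfl

theorem ofTangent_eq_trivialization (hu : u ∈ (extChartAt (𝓡 m) p₀).target)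
    (w : TangentSpace (𝓡 m) ((extChartAt (𝓡 m) p₀).symm u)) :
    ofTangent p₀ u w = (trivializationAt (EuclideanSpace ℝ (Fin m)) (TangentSpace (𝓡 m)) p₀
      ⟨(extChartAt (𝓡 m) p₀).symm u, w⟩).2 := by
  set e := trivializationAt (EuclideanSpace ℝ (Fin m)) (TangentSpace (𝓡 m)) p₀ with he
  have hb : (extChartAt (𝓡 m) p₀).symm u ∈ e.baseSet := mem_chart_source hu
  have h : w = toTangent p₀ u (e.continuousLinearMapAt ℝ _ w) := by
    rw [toTangent_eq_symmL hu, e.symmL_continuousLinearMapAt hb]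
  rw [h, ofTangent_toTangent hu, ← h, e.continuousLinearMapAt_apply (R := ℝ)]
  exact congrFun (e.coe_linearMapAt_of_mem hb) w

/-- A vector field is smooth at a point of the chart domain in the chart domain iff its components are. -/
theorem contDiffAt_hat_iff (hu : u ∈ (extChartAt (𝓡 m) p₀).target) (X : VField m M) :
    ContDiffAt ℝ ∞ (hat p₀ X) u ↔
      ContMDiffAt (𝓡 m) ((𝓡 m).prod (𝓡 m)) ∞
        (fun q ↦ (⟨q, X q⟩ : TotalSpace (EuclideanSpace ℝ (Fin m)) (TangentSpace (𝓡 m))))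
        ((extChartAt (𝓡 m) p₀).symm u) := by
  set e := trivializationAt (EuclideanSpace ℝ (Fin m)) (TangentSpace (𝓡 m)) p₀ with he
  have hb : (extChartAt (𝓡 m) p₀).symm u ∈ e.baseSet := mem_chart_source hu
  have : IsManifold (𝓡 m) (∞ + 1) M := ‹_›
  have hU := (isOpen_extChartAt_target (I := 𝓡 m) p₀).mem_nhds hu
  rw [e.contMDiffAt_section_iff hb, ← contMDiffAt_iff_contDiffAt]
  constructor
  · intro h
    have h1 : ContMDiffAt (𝓡 m) (𝓡 m) ∞ (extChartAt (𝓡 m) p₀) ((extChartAt (𝓡 m) p₀).symm u) :=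
      (contMDiffAt_extChartAt' (n := ∞) (mem_chart_source hu))
    rw [← (extChartAt (𝓡 m) p₀).right_inv hu] at h
    refine (h.comp _ h1).congr_of_eventuallyEq ?_
    filter_upwards [(isOpen_extChartAt_source (I := 𝓡 m) p₀).mem_nhds
      ((extChartAt (𝓡 m) p₀).map_target hu)] with q hq
    exact (congrArg (fun q ↦ (e ⟨q, X q⟩).2) ((extChartAt (𝓡 m) p₀).left_inv hq)).symm.trans
      (ofTangent_eq_trivialization ((extChartAt (𝓡 m) p₀).map_source hq) _).symm
  · intro h
    refine (h.comp u (contMDiffAt_symm hu)).congr_of_eventuallyEq ?_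
    filter_upwards [hU] with v hv
    exact ofTangent_eq_trivialization hv _


variable (g : PseudoRiemannianMetric m M)

/-- The components of a metric in the chart at `p₀`. -/
def hatMetric (p₀ : M) (u : EuclideanSpace ℝ (Fin m)) :
    EuclideanSpace ℝ (Fin m) →L[ℝ] EuclideanSpace ℝ (Fin m) →L[ℝ] ℝ :=
  precomp ℝ (toTangent p₀ u) ∘L g.val ((extChartAt (𝓡 m) p₀).symm u) ∘L toTangent p₀ u

theorem hatMetric_apply (v w : EuclideanSpace ℝ (Fin m)) : hatMetric g p₀ u v w
    = g.val ((extChartAt (𝓡 m) p₀).symm u) (toTangent p₀ u v) (toTangent p₀ u w) := rfl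

theorem hatMetric_hat (hu : u ∈ (extChartAt (𝓡 m) p₀).target) (X Y : VField m M) :
    hatMetric g p₀ u (hat p₀ X u) (hat p₀ Y u)
      = g.val ((extChartAt (𝓡 m) p₀).symm u) (X ((extChartAt (𝓡 m) p₀).symm u))
        (Y ((extChartAt (𝓡 m) p₀).symm u)) := by
  rw [hatMetric_apply, toTangent_hat hu, toTangent_hat hu]

/-- The vector field with constant components `v` in the chart at `p₀`. -/
def coordField (p₀ : M) (v : EuclideanSpace ℝ (Fin m)) : VField m M := fun q ↦
  (trivializationAt (EuclideanSpace ℝ (Fin m)) (TangentSpace (𝓡 m)) p₀).symmL ℝ q v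

theorem hat_coordField (hu : u ∈ (extChartAt (𝓡 m) p₀).target) (v : EuclideanSpace ℝ (Fin m)) :
    hat p₀ (coordField p₀ v) u = v := by
  rw [hat, coordField, ← toTangent_eq_symmL hu, ofTangent_toTangent hu]

theorem contDiffAt_hat_coordField (hu : u ∈ (extChartAt (𝓡 m) p₀).target)
    (v : EuclideanSpace ℝ (Fin m)) : ContDiffAt ℝ ∞ (hat p₀ (coordField p₀ v)) u :=
  (contDiffAt_const (c := v)).congr_of_eventuallyEq (eventuallyEq_of_mem
    ((isOpen_extChartAt_target p₀).mem_nhds hu) fun _ hw ↦ hat_coordField hw v)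

theorem contMDiffAt_metric_apply {q : M} {X Y : VField m M}
    (hX : ContMDiffAt (𝓡 m) ((𝓡 m).prod (𝓡 m)) ∞
        (fun q ↦ (⟨q, X q⟩ : TotalSpace (EuclideanSpace ℝ (Fin m)) (TangentSpace (𝓡 m)))) q)
    (hY : ContMDiffAt (𝓡 m) ((𝓡 m).prod (𝓡 m)) ∞
        (fun q ↦ (⟨q, Y q⟩ : TotalSpace (EuclideanSpace ℝ (Fin m)) (TangentSpace (𝓡 m)))) q) :
    ContMDiffAt (𝓡 m) 𝓘(ℝ, ℝ) ∞ (fun q ↦ g.val q (X q) (Y q)) q := by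
  have h := ContMDiffAt.clm_bundle_apply₂ (F₃ := ℝ) (E₃ := fun _ : M ↦ ℝ) (b := id)
    (g.contMDiff q) hX hY
  simpa using (contMDiffAt_totalSpace.1 h).2

theorem contDiffAt_clm_of_apply {F : Type*} [NormedAddCommGroup F] [NormedSpace ℝ F]
    {E : Type*} [NormedAddCommGroup E] [NormedSpace ℝ E] [FiniteDimensional ℝ E]
    {U : Set E} (hU : IsOpen U) {f : E → E →L[ℝ] F}
    (h : ∀ v ∈ U, ∀ x, ContDiffAt ℝ ∞ (fun w ↦ f w x) v) {u : E} (hu : u ∈ U) :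
    ContDiffAt ℝ ∞ f u :=
  (contDiffOn_clm_apply.2 fun x v hv ↦ (h v hv x).contDiffWithinAt).contDiffAt (hU.mem_nhds hu)

theorem isMetricOn_hatMetric (p₀ : M) :
    IsMetricOn (extChartAt (𝓡 m) p₀).target (hatMetric g p₀) where
  isOpen := isOpen_extChartAt_target p₀
  contDiffAt hu := by
    refine contDiffAt_clm_of_apply (isOpen_extChartAt_target p₀) (fun u hu x ↦ ?_) hu
    refine contDiffAt_clm_of_apply (isOpen_extChartAt_target p₀) (fun u hu y ↦ ?_) hu
    have h := (contMDiffAt_metric_apply g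
      ((contDiffAt_hat_iff hu _).1 (contDiffAt_hat_coordField hu x))
      ((contDiffAt_hat_iff hu _).1 (contDiffAt_hat_coordField hu y))).comp u (contMDiffAt_symm hu)
    refine (contMDiffAt_iff_contDiffAt.1 h).congr_of_eventuallyEq ?_
    filter_upwards [(isOpen_extChartAt_target (I := 𝓡 m) p₀).mem_nhds hu] with v hv
    have := hatMetric_hat g hv (coordField p₀ x) (coordField p₀ y)
    rwa [hat_coordField hv, hat_coordField hv] at this
  symm hu x y := g.symm _ _ _
  nondeg {u} hu x h := by
    refine (isInvertible_toTangent hu).injective ?_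
    rw [map_zero]
    refine g.nondegenerate _ _ fun v ↦ ?_
    rw [← toTangent_ofTangent hu v]
    exact h _

theorem contDiffAt_hatEnd {A : (p : M) → TangentSpace (𝓡 m) p →L[ℝ] TangentSpace (𝓡 m) p}
    (hA : ContMDiff (𝓡 m)
    ((𝓡 m).prod 𝓘(ℝ, EuclideanSpace ℝ (Fin m) →L[ℝ] EuclideanSpace ℝ (Fin m))) ∞
    (fun p ↦ TotalSpace.mk' (EuclideanSpace ℝ (Fin m) →L[ℝ] EuclideanSpace ℝ (Fin m))
      (E := fun p : M ↦ TangentSpace (𝓡 m) p →L[ℝ] TangentSpace (𝓡 m) p) p (A p)))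
    (hu : u ∈ (extChartAt (𝓡 m) p₀).target) : ContDiffAt ℝ ∞ (hatEnd p₀ A) u := by
  refine contDiffAt_clm_of_apply (isOpen_extChartAt_target p₀) (fun u hu x ↦ ?_) hu
  have h := (hA _).clm_bundle_apply (b := id)
    ((contDiffAt_hat_iff hu _).1 (contDiffAt_hat_coordField hu x))
  refine ((contDiffAt_hat_iff hu (fun q ↦ A q (coordField p₀ x q))).2 h).congr_of_eventuallyEq ?_
  filter_upwards [(isOpen_extChartAt_target (I := 𝓡 m) p₀).mem_nhds hu] with v hv
  simp only [hat, hatEnd, coordField, ← toTangent_eq_symmL hv, comp_apply]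

theorem hat_end_apply (hu : u ∈ (extChartAt (𝓡 m) p₀).target)
    (A : (p : M) → TangentSpace (𝓡 m) p →L[ℝ] TangentSpace (𝓡 m) p) (X : VField m M) :
    hat p₀ (fun q ↦ A q (X q)) u = hatEnd p₀ A u (hat p₀ X u) := by
  simp only [hatEnd, comp_apply, toTangent_hat hu]
  rfl

theorem contDiffAt_hat_ext (hu : u ∈ (extChartAt (𝓡 m) p₀).target)
    (v : TangentSpace (𝓡 m) ((extChartAt (𝓡 m) p₀).symm u)) :
    ContDiffAt ℝ ∞ (hat p₀ (ext v)) u :=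
  (contDiffAt_hat_iff hu _).2 (FiberBundle.contMDiffAt_extend (k := ∞) (𝓡 m) (EuclideanSpace ℝ (Fin m)) v)

theorem ext_self {p : M} (v : TangentSpace (𝓡 m) p) : ext v p = v :=
  FiberBundle.extend_apply_self _ v

theorem hat_ext (v : TangentSpace (𝓡 m) ((extChartAt (𝓡 m) p₀).symm u)) :
    hat p₀ (ext v) u = ofTangent p₀ u v := by
  rw [hat, ext_self]

/-- The Lie bracket is computed in a chart, by its invariance under pullback. -/
theorem hat_mlieBracket (hu : u ∈ (extChartAt (𝓡 m) p₀).target) {X Y : VField m M}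
    (hX : ContDiffAt ℝ ∞ (hat p₀ X) u) (hY : ContDiffAt ℝ ∞ (hat p₀ Y) u) :
    hat p₀ (VectorField.mlieBracket (𝓡 m) X Y) u
      = VectorField.lieBracket ℝ (hat p₀ X) (hat p₀ Y) u := by
  have : IsManifold (𝓡 m) (minSmoothness ℝ 2) M :=
    IsManifold.of_le (n := ∞) (by simp; norm_cast)
  have h := VectorField.mpullback_mlieBracket (I := 𝓡 m) (I' := 𝓡 m) (n := ∞)
    (((contDiffAt_hat_iff hu X).1 hX).mdifferentiableAt (n := ∞) (by simp))
    (((contDiffAt_hat_iff hu Y).1 hY).mdifferentiableAt (n := ∞) (by simp)) (contMDiffAt_symm hu)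
    (by simp; norm_cast)
  refine h.trans ?_
  rw [← VectorField.mlieBracketWithin_univ, ← VectorField.lieBracketWithin_univ]
  exact congrFun (VectorField.mlieBracketWithin_eq_lieBracketWithin (𝕜 := ℝ)) u

/-- The derivative of a function along a vector field, computed in a chart. -/
theorem mvfderiv_eq (hu : u ∈ (extChartAt (𝓡 m) p₀).target) {f : M → ℝ}
    (hf : MDifferentiableAt (𝓡 m) 𝓘(ℝ, ℝ) f ((extChartAt (𝓡 m) p₀).symm u))
    {F : EuclideanSpace ℝ (Fin m) → ℝ}
    (hF : ∀ v ∈ (extChartAt (𝓡 m) p₀).target, F v = f ((extChartAt (𝓡 m) p₀).symm v))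
    (X : VField m M) :
    mvfderiv (𝓡 m) f ((extChartAt (𝓡 m) p₀).symm u) (X ((extChartAt (𝓡 m) p₀).symm u))
      = fderiv ℝ F u (hat p₀ X u) := by
  have h1 : F =ᶠ[𝓝 u] f ∘ (extChartAt (𝓡 m) p₀).symm :=
    eventuallyEq_of_mem ((isOpen_extChartAt_target p₀).mem_nhds hu) hF
  rw [h1.fderiv_eq, ← mfderiv_eq_fderiv, mfderiv_comp u hf
    ((contMDiffAt_symm hu).mdifferentiableAt (n := ∞) (by simp))]
  rw [← toTangent_hat hu X]
  rfl

end Charts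

/-! ### The Levi-Civita connection and the curvature in a chart -/

section ChartConnection

open ContinuousLinearMap Filter Topology Set

variable {m : ℕ} {M : Type*} [TopologicalSpace M] [ChartedSpace (EuclideanSpace ℝ (Fin m)) M]

theorem sum_coord_smul_frame {p : M} (v : TangentSpace (𝓡 m) p) :
    ∑ i, coord v i • frame p i = v := by
  have h := (EuclideanSpace.basisFun (Fin m) ℝ).sum_repr (v : EuclideanSpace ℝ (Fin m))
  simp only [EuclideanSpace.basisFun_apply] at h
  exact h

theorem sum_single_eq_trace (T : EuclideanSpace ℝ (Fin m) →ₗ[ℝ] EuclideanSpace ℝ (Fin m)) :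
    ∑ i, T (EuclideanSpace.single i (1 : ℝ)) i = LinearMap.trace ℝ _ T := by
  rw [LinearMap.trace_eq_matrix_trace ℝ (EuclideanSpace.basisFun (Fin m) ℝ).toBasis]
  simp [Matrix.trace, Matrix.diag_apply, LinearMap.toMatrix_apply]

theorem sum_coord_eq_trace {p : M} (T : TangentSpace (𝓡 m) p →ₗ[ℝ] TangentSpace (𝓡 m) p) :
    ∑ i, coord (T (frame p i)) i = LinearMap.trace ℝ _ T :=
  sum_single_eq_trace T

variable [IsManifold (𝓡 m) ∞ M] {p₀ : M} {u : EuclideanSpace ℝ (Fin m)}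
  (g : PseudoRiemannianMetric m M)

theorem gram_mulVec {p : M} (c : Fin m → ℝ) (j : Fin m) :
    (g.gram p *ᵥ c) j = g.val p (∑ i, c i • frame p i) (frame p j) := by
  rw [g.symm]
  simp [Matrix.mulVec, dotProduct, PseudoRiemannianMetric.gram, mul_comm]

theorem isUnit_gram (p : M) : IsUnit (g.gram p) := by
  rw [← Matrix.mulVec_injective_iff_isUnit]
  refine (injective_iff_map_eq_zero (g.gram p).mulVecLin).2 fun c hc ↦ ?_
  have h0 : ∑ i, c i • frame p i = 0 := g.nondegenerate p _ fun v ↦ by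
    rw [← sum_coord_smul_frame v, map_sum]
    refine Finset.sum_eq_zero fun j _ ↦ ?_
    rw [map_smul, ← gram_mulVec, show (g.gram p *ᵥ c) j = 0 from congrFun hc j, smul_zero]
  have h1 := sum_coord_smul_frame (p := p) (WithLp.toLp 2 c : EuclideanSpace ℝ (Fin m))
  have h2 : (WithLp.toLp 2 c : EuclideanSpace ℝ (Fin m)) = 0 := h1.symm.trans h0
  exact congrArg WithLp.ofLp h2

/-- The Koszul formula against the coordinate basis determines `∇_X Y`. -/
theorem nabla_unique {X Y : VField m M} {p : M} (w : TangentSpace (𝓡 m) p)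
    (h : ∀ j, g.koszul X Y (ext (frame p j)) p = g.val p w (frame p j)) :
    g.nabla X Y p = w := by
  have hw : ∀ i, ∑ j, (g.gram p)⁻¹ i j * g.val p w (frame p j) = coord w i := fun i ↦ by
    have h1 : ∀ j, g.val p w (frame p j) = (g.gram p *ᵥ coord w) j := fun j ↦ by
      rw [gram_mulVec, sum_coord_smul_frame]
    simp only [h1]
    change ((g.gram p)⁻¹ *ᵥ (g.gram p *ᵥ coord w)) i = _
    rw [Matrix.mulVec_mulVec, Matrix.nonsing_inv_mul _ ((Matrix.isUnit_iff_isUnit_det _).1 (isUnit_gram g p)), Matrix.one_mulVec]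
  simp only [PseudoRiemannianMetric.nabla, h, ← Finset.sum_smul, hw]
  exact sum_coord_smul_frame w

theorem mvfderiv_metric_apply (hu : u ∈ (extChartAt (𝓡 m) p₀).target) {X Y : VField m M}
    (hX : ContDiffAt ℝ ∞ (hat p₀ X) u) (hY : ContDiffAt ℝ ∞ (hat p₀ Y) u) (Z : VField m M) :
    mvfderiv (𝓡 m) (fun q ↦ g.val q (X q) (Y q)) ((extChartAt (𝓡 m) p₀).symm u)
      (Z ((extChartAt (𝓡 m) p₀).symm u))
      = fderiv ℝ (fun v ↦ hatMetric g p₀ v (hat p₀ X v) (hat p₀ Y v)) u (hat p₀ Z u) :=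
  mvfderiv_eq hu ((contMDiffAt_metric_apply g ((contDiffAt_hat_iff hu X).1 hX)
    ((contDiffAt_hat_iff hu Y).1 hY)).mdifferentiableAt (by simp))
    (fun _ hv ↦ hatMetric_hat g hv X Y) Z

theorem koszul_eq (hu : u ∈ (extChartAt (𝓡 m) p₀).target) {X Y Z : VField m M}
    (hX : ContDiffAt ℝ ∞ (hat p₀ X) u) (hY : ContDiffAt ℝ ∞ (hat p₀ Y) u)
    (hZ : ContDiffAt ℝ ∞ (hat p₀ Z) u) :
    g.koszul X Y Z ((extChartAt (𝓡 m) p₀).symm u)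
      = hatMetric g p₀ u (covDeriv (hatMetric g p₀) (hat p₀ X) (hat p₀ Y) u) (hat p₀ Z u) := by
  rw [(isMetricOn_hatMetric g p₀).koszul_formula hu (hX.differentiableAt (by simp))
    (hY.differentiableAt (by simp)) (hZ.differentiableAt (by simp)),
    ← hat_mlieBracket hu hX hY, ← hat_mlieBracket hu hX hZ, ← hat_mlieBracket hu hY hZ,
    hatMetric_hat g hu, hatMetric_hat g hu, hatMetric_hat g hu, ← mvfderiv_metric_apply g hu hY hZ,
    ← mvfderiv_metric_apply g hu hX hZ, ← mvfderiv_metric_apply g hu hX hY]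
  rfl

theorem hat_nabla (hu : u ∈ (extChartAt (𝓡 m) p₀).target) {X Y : VField m M}
    (hX : ContDiffAt ℝ ∞ (hat p₀ X) u) (hY : ContDiffAt ℝ ∞ (hat p₀ Y) u) :
    hat p₀ (g.nabla X Y) u = covDeriv (hatMetric g p₀) (hat p₀ X) (hat p₀ Y) u := by
  have h := nabla_unique g (X := X) (Y := Y)
    (toTangent p₀ u (covDeriv (hatMetric g p₀) (hat p₀ X) (hat p₀ Y) u)) fun j ↦ by
      rw [koszul_eq g hu hX hY (contDiffAt_hat_ext hu _), hatMetric_apply, toTangent_hat hu,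
        ext_self]
  rw [hat, h, ofTangent_toTangent hu]

theorem contDiffAt_covDeriv {U : Set (EuclideanSpace ℝ (Fin m))}
    {G : EuclideanSpace ℝ (Fin m) → EuclideanSpace ℝ (Fin m) →L[ℝ] EuclideanSpace ℝ (Fin m) →L[ℝ] ℝ}
    (hG : IsMetricOn U G) (hu : u ∈ U) {X Y : EuclideanSpace ℝ (Fin m) → EuclideanSpace ℝ (Fin m)}
    (hX : ContDiffAt ℝ ∞ X u) (hY : ContDiffAt ℝ ∞ Y u) : ContDiffAt ℝ ∞ (covDeriv G X Y) u :=
  ((hY.fderiv_right (by simp)).clm_apply hX).add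
    (((hG.contDiffAt_christoffel hu).clm_apply hX).clm_apply hY)

theorem eventually_contDiffAt_hat (hu : u ∈ (extChartAt (𝓡 m) p₀).target)
    (v : TangentSpace (𝓡 m) ((extChartAt (𝓡 m) p₀).symm u)) :
    ∀ᶠ v' in 𝓝 u, ContDiffAt ℝ ∞ (hat p₀ (ext v)) v' := by
  obtain ⟨s, hs, h⟩ := FiberBundle.exists_contMDiffOn_extend (k := ∞) (𝓡 m)
    (EuclideanSpace ℝ (Fin m)) v
  filter_upwards [(contMDiffAt_symm hu).continuousAt (eventually_mem_nhds_iff.2 hs),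
    (isOpen_extChartAt_target (I := 𝓡 m) p₀).mem_nhds hu] with v' hv' hv'u
  exact (contDiffAt_hat_iff hv'u _).2 (h.contMDiffAt hv')

theorem covDeriv_congr {G : EuclideanSpace ℝ (Fin m) →
      EuclideanSpace ℝ (Fin m) →L[ℝ] EuclideanSpace ℝ (Fin m) →L[ℝ] ℝ}
    {X Y Z : EuclideanSpace ℝ (Fin m) → EuclideanSpace ℝ (Fin m)} (h : Y =ᶠ[𝓝 u] Z) :
    covDeriv G X Y u = covDeriv G X Z u := by
  rw [covDeriv, covDeriv, h.fderiv_eq, h.eq_of_nhds]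

/-- The components of the curvature. The fields `ext x`, `ext y`, `ext z` have constant components in
the preferred chart at the point with coordinates `u`, not in the chart at `p₀`, so their components
here vary; the curvature is nevertheless the tensor `curvEnd`. -/
theorem ofTangent_curvature (hu : u ∈ (extChartAt (𝓡 m) p₀).target)
    (x y z : TangentSpace (𝓡 m) ((extChartAt (𝓡 m) p₀).symm u)) :
    ofTangent p₀ u (g.curvature _ x y z) = curvEnd (hatMetric g p₀) u
      (ofTangent p₀ u x) (ofTangent p₀ u y) (ofTangent p₀ u z) := by
  have hG := isMetricOn_hatMetric g p₀
  have hx := contDiffAt_hat_ext hu x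
  have hy := contDiffAt_hat_ext hu y
  have hz := contDiffAt_hat_ext hu z
  have key : ∀ x y : TangentSpace (𝓡 m) ((extChartAt (𝓡 m) p₀).symm u),
      hat p₀ (g.nabla (ext x) (ext y)) =ᶠ[𝓝 u]
        covDeriv (hatMetric g p₀) (hat p₀ (ext x)) (hat p₀ (ext y)) := fun x y ↦ by
    filter_upwards [eventually_contDiffAt_hat hu x, eventually_contDiffAt_hat hu y,
      hG.mem_nhds hu] with v hx hy hv
    exact hat_nabla g hv hx hy
  have hbr : hat p₀ (VectorField.mlieBracket (𝓡 m) (ext x) (ext y)) =ᶠ[𝓝 u]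
      VectorField.lieBracket ℝ (hat p₀ (ext x)) (hat p₀ (ext y)) := by
    filter_upwards [eventually_contDiffAt_hat hu x, eventually_contDiffAt_hat hu y,
      hG.mem_nhds hu] with v hx hy hv
    exact hat_mlieBracket hv hx hy
  have hbs : ContDiffAt ℝ ∞
      (VectorField.lieBracket ℝ (hat p₀ (ext x)) (hat p₀ (ext y))) u :=
    ((hy.fderiv_right (by simp)).clm_apply hx).sub ((hx.fderiv_right (by simp)).clm_apply hy)
  have h2 : ∀ x y z : TangentSpace (𝓡 m) ((extChartAt (𝓡 m) p₀).symm u),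
      hat p₀ (g.nabla (ext x) (g.nabla (ext y) (ext z))) u = covDeriv (hatMetric g p₀)
        (hat p₀ (ext x))
        (covDeriv (hatMetric g p₀) (hat p₀ (ext y)) (hat p₀ (ext z))) u := fun x y z ↦ by
    rw [hat_nabla g hu (contDiffAt_hat_ext hu x) ((contDiffAt_covDeriv hG hu
      (contDiffAt_hat_ext hu y) (contDiffAt_hat_ext hu z)).congr_of_eventuallyEq (key y z)),
      covDeriv_congr (key y z)]
  have h3 : hat p₀ (g.nabla (VectorField.mlieBracket (𝓡 m) (ext x) (ext y)) (ext z)) u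
      = covDeriv (hatMetric g p₀) (VectorField.lieBracket ℝ (hat p₀ (ext x)) (hat p₀ (ext y)))
        (hat p₀ (ext z)) u := by
    rw [hat_nabla g hu (hbs.congr_of_eventuallyEq hbr) hz, covDeriv, covDeriv, hbr.eq_of_nhds]
  rw [← hat_ext x, ← hat_ext y, ← hat_ext z, ← hG.covDeriv_comm hu (hx.differentiableAt (by simp))
    (hy.differentiableAt (by simp)) (hz.of_le (by norm_cast)), ← h2, ← h2, ← h3,
    PseudoRiemannianMetric.curvature, map_sub, map_sub]
  rfl

/-- The Ricci tensor of the manifold is that of the metric read in any chart. -/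
theorem ricci_eq (hu : u ∈ (extChartAt (𝓡 m) p₀).target)
    (y z : TangentSpace (𝓡 m) ((extChartAt (𝓡 m) p₀).symm u)) :
    g.ricci _ y z
      = ricciForm (curvTrilin (hatMetric g p₀) u) (ofTangent p₀ u y) (ofTangent p₀ u z) := by
  rw [ricciForm]
  generalize hS : ((curvTrilin (hatMetric g p₀) u).flip (ofTangent p₀ u y)).flip
    (ofTangent p₀ u z) = S
  have h : ∀ x, g.curvature _ x y z
      = ((toTangent p₀ u).toLinearMap ∘ₗ (S ∘ₗ (ofTangent p₀ u).toLinearMap)) x := fun x ↦ by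
    rw [← toTangent_ofTangent hu (g.curvature _ x y z), ofTangent_curvature g hu, ← hS]
    rfl
  have hfin : FiniteDimensional ℝ (TangentSpace (𝓡 m) ((extChartAt (𝓡 m) p₀).symm u)) :=
    inferInstanceAs (FiniteDimensional ℝ (EuclideanSpace ℝ (Fin m)))
  have h2 : (S ∘ₗ (ofTangent p₀ u).toLinearMap) ∘ₗ (toTangent p₀ u).toLinearMap = S :=
    LinearMap.ext fun v ↦ congrArg S (ofTangent_toTangent hu v)
  have h3 : g.ricci _ y z = ∑ i, coord (((toTangent p₀ u).toLinearMap ∘ₗ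
      (S ∘ₗ (ofTangent p₀ u).toLinearMap)) (frame _ i)) i :=
    Finset.sum_congr rfl fun i _ ↦ congrArg (fun w ↦ coord w i) (h _)
  rw [h3, sum_coord_eq_trace, LinearMap.trace_comp_comm' (S ∘ₗ (ofTangent p₀ u).toLinearMap), h2]

theorem ofTangent_nablaEnd (hu : u ∈ (extChartAt (𝓡 m) p₀).target)
    {A : (p : M) → TangentSpace (𝓡 m) p →L[ℝ] TangentSpace (𝓡 m) p}
    (hA : ContMDiff (𝓡 m)
    ((𝓡 m).prod 𝓘(ℝ, EuclideanSpace ℝ (Fin m) →L[ℝ] EuclideanSpace ℝ (Fin m))) ∞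
    (fun p ↦ TotalSpace.mk' (EuclideanSpace ℝ (Fin m) →L[ℝ] EuclideanSpace ℝ (Fin m))
      (E := fun p : M ↦ TangentSpace (𝓡 m) p →L[ℝ] TangentSpace (𝓡 m) p) p (A p)))
    (x y : TangentSpace (𝓡 m) ((extChartAt (𝓡 m) p₀).symm u)) :
    ofTangent p₀ u (g.nablaEnd A _ x y)
      = covDerivEnd (hatMetric g p₀) (hatEnd p₀ A) u (ofTangent p₀ u x) (ofTangent p₀ u y) := by
  have hx := contDiffAt_hat_ext hu x
  have hy := contDiffAt_hat_ext hu y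
  have hAu := contDiffAt_hatEnd (p₀ := p₀) hA hu
  have h1 : hat p₀ (fun q ↦ A q (ext y q)) =ᶠ[𝓝 u]
      fun v ↦ hatEnd p₀ A v (hat p₀ (ext y) v) :=
    eventuallyEq_of_mem ((isOpen_extChartAt_target p₀).mem_nhds hu)
      fun v hv ↦ hat_end_apply hv A (ext y)
  have h2 := hat_nabla g hu hx ((hAu.clm_apply hy).congr_of_eventuallyEq h1)
  have h3 := hat_end_apply hu A (g.nabla (ext x) (ext y))
  rw [covDeriv_congr h1] at h2
  rw [hat_nabla g hu hx hy] at h3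
  have h4 : ofTangent p₀ u (g.nablaEnd A _ x y)
      = hat p₀ (g.nabla (ext x) fun q ↦ A q (ext y q)) u
        - hat p₀ (fun q ↦ A q (g.nabla (ext x) (ext y) q)) u := map_sub _ _ _
  rw [h4, h2, h3, covDeriv, covDeriv, fderiv_clm_apply (hAu.differentiableAt (by simp))
    (hy.differentiableAt (by simp)), hat_ext, hat_ext, covDerivEnd_apply]
  simp [mul_def]
  abel

/-- A quaternionic Kähler manifold, read in a chart. -/
theorem isQuaternionicKahlerOn {H : AlmostHypercomplex m M} {g : PseudoRiemannianMetric m M}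
    (hNH : IsNHMetric H g) (hQK : IsQuaternionicKahler H g) (p₀ : M) :
    IsQuaternionicKahlerOn (extChartAt (𝓡 m) p₀).target (hatMetric g p₀)
      fun a ↦ hatEnd p₀ (H.J a) where
  toIsMetricOn := isMetricOn_hatMetric g p₀
  contDiffAt_J a _ hu := contDiffAt_hatEnd (H.contMDiff a) hu
  sq a u hu := by
    ext1 v
    simp only [mul_def, hatEnd, comp_apply, toTangent_ofTangent hu, H.sq, map_neg,
      ofTangent_toTangent hu]
    rfl
  mul a u hu := by
    ext1 v
    simp only [mul_def, hatEnd, comp_apply, toTangent_ofTangent hu]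
    rw [H.mul a]
  mul' a u hu := by
    ext1 v
    simp only [mul_def, hatEnd, comp_apply, toTangent_ofTangent hu, neg_apply]
    rw [H.mul' a, map_neg]
  compatible a u hu x y := by
    rw [hatMetric_apply, hatMetric_apply, hNH.compatible a]
    simp only [hatEnd, comp_apply, toTangent_ofTangent hu]
  parallel a u hu x := by
    obtain ⟨c, hc⟩ := hQK a _ (toTangent p₀ u x)
    refine ⟨c, ?_⟩
    ext1 y
    have h := ofTangent_nablaEnd g hu (H.contMDiff a) (toTangent p₀ u x) (toTangent p₀ u y)
    rw [ofTangent_toTangent hu, ofTangent_toTangent hu] at h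
    rw [← h, hc, map_sum]
    simp only [hatEnd, sum_apply, smul_apply, comp_apply, (ofTangent p₀ u).map_smul]

/-- The metric of a quaternionic Kähler manifold is Einstein at every point. -/
theorem exists_ricci_eq_smul {n : ℕ} (hn : 2 ≤ n) (hm : m = 4 * n) {H : AlmostHypercomplex m M}
    {g : PseudoRiemannianMetric m M} (hNH : IsNHMetric H g) (hQK : IsQuaternionicKahler H g) (p : M) :
    ∃ c : ℝ, ∀ u v : TangentSpace (𝓡 m) p, g.ricci p u v = c * g.val p u v := by
  have hdim : Module.finrank ℝ (EuclideanSpace ℝ (Fin m)) = 4 * n := by simp [hm]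
  have hp := mem_extChartAt_target (I := 𝓡 m) p
  obtain ⟨c, hc, -⟩ := (isQuaternionicKahlerOn hNH hQK p).exists_einstein hn hdim hp
  rw [← (extChartAt (𝓡 m) p).left_inv (mem_extChartAt_source p)]
  refine ⟨c, fun u v ↦ ?_⟩
  rw [ricci_eq g hp, hc, hatMetric_apply, toTangent_ofTangent hp, toTangent_ofTangent hp]

theorem isLocallyConstant_of_ricci_eq_smul {n : ℕ} (hn : 2 ≤ n) (hm : m = 4 * n)
    {H : AlmostHypercomplex m M} {g : PseudoRiemannianMetric m M} (hNH : IsNHMetric H g)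
    (hQK : IsQuaternionicKahler H g) {lam : M → ℝ}
    (hlam : ∀ (p : M) (u v : TangentSpace (𝓡 m) p), g.ricci p u v = lam p * g.val p u v) :
    IsLocallyConstant lam := by
  have hdim : Module.finrank ℝ (EuclideanSpace ℝ (Fin m)) = 4 * n := by simp [hm]
  refine (IsLocallyConstant.iff_eventually_eq lam).2 fun p ↦ ?_
  have hopen := isOpen_extChartAt_target (I := 𝓡 m) p
  have hder : ∀ u ∈ (extChartAt (𝓡 m) p).target,
      HasFDerivAt (fun v ↦ lam ((extChartAt (𝓡 m) p).symm v))
        (0 : EuclideanSpace ℝ (Fin m) →L[ℝ] ℝ) u := fun u hu ↦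
    (isQuaternionicKahlerOn hNH hQK p).hasFDerivAt_einstein hn hdim (fun v hv y z ↦ by
      have h := ricci_eq g hv (toTangent p v y) (toTangent p v z)
      rw [ofTangent_toTangent hv, ofTangent_toTangent hv] at h
      rw [← h, hlam, hatMetric_apply]) hu
  obtain ⟨r, hr, hball⟩ := Metric.isOpen_iff.1 hopen _ (mem_extChartAt_target (I := 𝓡 m) p)
  filter_upwards [extChartAt_source_mem_nhds (I := 𝓡 m) p,
    (continuousAt_extChartAt (I := 𝓡 m) p) (Metric.ball_mem_nhds _ hr)] with q hq hqr
  have h := Metric.isOpen_ball.is_const_of_fderiv_eq_zero (𝕜 := ℝ)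
    (convex_ball (extChartAt (𝓡 m) p p) r).isPreconnected
    (fun u hu ↦ (hder u (hball hu)).differentiableAt.differentiableWithinAt)
    (fun u hu ↦ (hder u (hball hu)).fderiv) hqr (Metric.mem_ball_self hr)
  simpa only [(extChartAt (𝓡 m) p).left_inv hq, extChartAt_to_inv] using h

end ChartConnection

end NHGeometry

end

theorem theorem2p7 (n : ℕ) (hn : 2 ≤ n) {M : Type*} [TopologicalSpace M]
    [ChartedSpace (EuclideanSpace ℝ (Fin (4 * n))) M] [IsManifold (𝓡 (4 * n)) ∞ M]
    (H : NHGeometry.AlmostHypercomplex (4 * n) M)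
    (g : NHGeometry.PseudoRiemannianMetric (4 * n) M)
    (hNH : NHGeometry.IsNHMetric H g)
    (hQK : NHGeometry.IsQuaternionicKahler H g) :
    (∃ lam : M → ℝ, IsLocallyConstant lam ∧
      ∀ (p : M) (u v : TangentSpace (𝓡 (4 * n)) p), g.ricci p u v = lam p * g.val p u v) ∧
    (PreconnectedSpace M → ∃ lam : ℝ,
      ∀ (p : M) (u v : TangentSpace (𝓡 (4 * n)) p), g.ricci p u v = lam * g.val p u v) := by
  choose lam hlam using NHGeometry.exists_ricci_eq_smul hn rfl hNH hQK
  have hloc := NHGeometry.isLocallyConstant_of_ricci_eq_smul hn rfl hNH hQK hlam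
  refine ⟨⟨lam, hloc, hlam⟩, fun _ ↦ ?_⟩
  rcases isEmpty_or_nonempty M with hM | ⟨⟨p₀⟩⟩
  · exact ⟨0, fun p ↦ (hM.false p).elim⟩
  · exact ⟨lam p₀, fun p u v ↦ by rw [hlam, hloc.apply_eq_of_preconnectedSpace p p₀]⟩
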